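/- Let $(M,d)$ be a complete metric space with more than one point and let $0\in M$ be a distinguished point. Let $\mathrm{Lip}_0(M)$ be the Banach space of all Lipschitz functions $f\colon M\to\mathbb R$ with $f(0)=0$, normed by $\|f\|=\sup\{|f(p)-f(q)|/d(p,q): p,q\in M,\ p\neq q\}$, and let the Lipschitz-free space $\mathcal F(M)$ be the closed linear span in $\mathrm{Lip}_0(M)^*$ of the evaluation functionals $\delta_p\colon f\mapsto f(p)$, $p\in M$. Then the following hold. (1) $\mathcal F(M)$ is locally almost square if and only if $M$ is a length space. (2) $\mathcal F(M)$ is locally almost square if and only if $\mathcal F(M)$ has the Daugavet property. Here a real Banach space $X\neq\{0\}$ is *locally almost square* if for every $\varepsilon>0$ and every $x\in X$ with $\|x\|=1$ there is $y\in X$ with $\|y\|=1$, $\|x+y\|\le 1+\varepsilon$ and $\|x-y\|\le 1+\varepsilon$; it has the *Daugavet property* if $\|\mathrm{Id}+T\|=1+\|T\|$ for every rank-one bounded linear operator $T\colon X\to X$. The space $M$ is a *length space* if for all $p\neq q$ in $M$ the distance $d(p,q)$ is the infimum of the lengths of the rectifiable simple (i.e. injective) paths in $M$ from $p$ to $q$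 (in particular, such paths exist). -/

import Mathlib

open scoped NNReal

noncomputable section

namespace LipFree

section Lip

variable {M : Type*} [MetricSpace M]

/-- The vector space of real Lipschitz functions on `M` vanishing at the distinguished point `o`,
as a subspace of all functions. -/
def lip0Submodule (o : M) : Submodule ℝ (M → ℝ) where
  carrier := {f | (∃ K : ℝ≥0, LipschitzWith K f) ∧ f o = 0}
  zero_mem' := ⟨⟨0, LipschitzWith.const 0⟩, rfl⟩
  add_mem' := by
    rintro f g ⟨⟨K, hK⟩, hf⟩ ⟨⟨L, hL⟩, hg⟩
    exact ⟨⟨K + L, hK.add hL⟩, by simp [hf, hg]⟩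
  smul_mem' := by
    rintro c f ⟨⟨K, hK⟩, hf⟩
    refine ⟨⟨‖c‖₊ * K, ?_⟩, by simp [hf]⟩
    refine LipschitzWith.of_dist_le_mul fun x y => ?_
    have h := hK.dist_le_mul x y
    simp only [Pi.smul_apply, smul_eq_mul, Real.dist_eq, NNReal.coe_mul, coe_nnnorm,
      Real.norm_eq_abs] at h ⊢
    rw [← mul_sub, abs_mul, mul_assoc]
    exact mul_le_mul_of_nonneg_left h (abs_nonneg c)

/-- The space `Lip₀(M)` of real Lipschitz functions on `M` vanishing at `o`. (A type of its own, so
that its topology is the one of the Lipschitz norm and not that of pointwise convergence.) -/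
def Lip0 (o : M) : Type _ := lip0Submodule o

variable {o : M}

instance instAddCommGroupLip0 : AddCommGroup (Lip0 o) :=
  inferInstanceAs (AddCommGroup (lip0Submodule o))

instance instModuleLip0 : Module ℝ (Lip0 o) :=
  inferInstanceAs (Module ℝ (lip0Submodule o))

instance instCoeFunLip0 : CoeFun (Lip0 o) (fun _ => M → ℝ) := ⟨fun f => f.1⟩

theorem Lip0.add_apply (f g : Lip0 o) (p : M) : (f + g) p = f p + g p := rfl

theorem Lip0.smul_apply (c : ℝ) (f : Lip0 o) (p : M) : (c • f) p = c * f p := rfl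

theorem Lip0.apply_base (f : Lip0 o) : f o = 0 := f.2.2

/-- The norm of `Lip₀(M)`: the supremum of `|f p - f q| / d(p, q)` over all `p ≠ q`. -/
instance instNormLip0 : Norm (Lip0 o) :=
  ⟨fun f => ⨆ z : {z : M × M // z.1 ≠ z.2}, |f z.1.1 - f z.1.2| / dist z.1.1 z.1.2⟩

theorem Lip0.norm_def (f : Lip0 o) :
    ‖f‖ = ⨆ z : {z : M × M // z.1 ≠ z.2}, |f z.1.1 - f z.1.2| / dist z.1.1 z.1.2 := rfl

theorem Lip0.bddAbove (f : Lip0 o) : BddAbove (Set.range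
    fun z : {z : M × M // z.1 ≠ z.2} => |f z.1.1 - f z.1.2| / dist z.1.1 z.1.2) := by
  obtain ⟨K, hK⟩ := f.2.1
  refine ⟨K, ?_⟩
  rintro _ ⟨z, rfl⟩
  have h := hK.dist_le_mul z.1.1 z.1.2
  rw [Real.dist_eq] at h
  exact (div_le_iff₀ (dist_pos.2 z.2)).2 h

theorem Lip0.norm_nonneg' (f : Lip0 o) : 0 ≤ ‖f‖ :=
  Real.iSup_nonneg fun _ => div_nonneg (abs_nonneg _) dist_nonneg

theorem Lip0.abs_sub_le (f : Lip0 o) (p q : M) : |f p - f q| ≤ ‖f‖ * dist p q := by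
  by_cases h : p = q
  · subst h; simp
  · exact (div_le_iff₀ (dist_pos.2 h)).1 (le_ciSup f.bddAbove ⟨(p, q), h⟩)

theorem Lip0.norm_le (f : Lip0 o) {C : ℝ} (hC : 0 ≤ C)
    (h : ∀ p q, |f p - f q| ≤ C * dist p q) : ‖f‖ ≤ C :=
  Real.iSup_le (fun z => (div_le_iff₀ (dist_pos.2 z.2)).2 (h z.1.1 z.1.2)) hC

theorem Lip0.normCore : NormedSpace.Core ℝ (Lip0 o) where
  norm_nonneg := Lip0.norm_nonneg'
  norm_smul := by
    intro c f
    rw [Lip0.norm_def, Lip0.norm_def, Real.norm_eq_abs, Real.mul_iSup_of_nonneg (abs_nonneg c)]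
    refine iSup_congr fun z => ?_
    rw [Lip0.smul_apply, Lip0.smul_apply, ← mul_sub, abs_mul, mul_div_assoc]
  norm_triangle := by
    intro f g
    refine Lip0.norm_le _ (add_nonneg f.norm_nonneg' g.norm_nonneg') fun p q => ?_
    have h1 := f.abs_sub_le p q
    have h2 := g.abs_sub_le p q
    have h3 := abs_add_le (f p - f q) (g p - g q)
    rw [Lip0.add_apply, Lip0.add_apply, add_sub_add_comm, add_mul]
    linarith
  norm_eq_zero_iff := by
    intro f
    constructor
    · intro h
      refine Subtype.ext (funext fun p => ?_)
      have h1 := f.abs_sub_le p o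
      rw [h, zero_mul, f.apply_base, sub_zero] at h1
      exact abs_nonpos_iff.1 h1
    · rintro rfl
      refine le_antisymm (Lip0.norm_le _ le_rfl fun p q => ?_) (Lip0.norm_nonneg' _)
      have h0 : ∀ r : M, (0 : Lip0 o) r = 0 := fun _ => rfl
      simp [h0]

instance instNormedAddCommGroupLip0 : NormedAddCommGroup (Lip0 o) :=
  NormedAddCommGroup.ofCore Lip0.normCore

instance instNormedSpaceLip0 : NormedSpace ℝ (Lip0 o) :=
  NormedSpace.ofCore Lip0.normCore

/-- The evaluation functional `δ_p`, `δ_p f = f p`, in the dual of `Lip₀(M)`. -/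
def delta (o p : M) : StrongDual ℝ (Lip0 o) :=
  LinearMap.mkContinuous
    { toFun := fun f => f p
      map_add' := fun _ _ => rfl
      map_smul' := fun _ _ => rfl }
    (dist p o) (fun f => by
      have h := f.abs_sub_le p o
      rw [f.apply_base, sub_zero, mul_comm] at h
      exact h)

theorem delta_apply (o p : M) (f : Lip0 o) : delta o p f = f p := rfl

/-- The Lipschitz-free space `F(M)`: the closed linear span of the evaluation functionals in the
dual of `Lip₀(M)`, with the dual norm. -/
def freeSpace (o : M) : Submodule ℝ (StrongDual ℝ (Lip0 o)) :=
  (Submodule.span ℝ (Set.range (delta o))).topologicalClosure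

end Lip

/-- `M` is a length space: the distance of any two different points is the infimum of the lengths
of the rectifiable simple (that is, injective) paths joining them. The infimum is taken in
`[0, ∞]`, so it is `∞` if there is no such path. -/
def IsLengthSpace (M : Type*) [MetricSpace M] : Prop :=
  ∀ p q : M, p ≠ q →
    edist p q = ⨅ (γ : Path p q) (_ : Function.Injective γ) (_ : eVariationOn γ Set.univ ≠ ⊤),
      eVariationOn γ Set.univ

/-- A real normed space is locally almost square. -/
def IsLASQ (X : Type*) [NormedAddCommGroup X] [NormedSpace ℝ X] : Prop :=
  ∀ ε : ℝ, 0 < ε → ∀ x : X, ‖x‖ = 1 → ∃ y : X, ‖y‖ = 1 ∧ ‖x + y‖ ≤ 1 + ε ∧ ‖x - y‖ ≤ 1 + ε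

/-- The Daugavet property of a real normed space `X ≠ 0`: `‖Id + T‖ = 1 + ‖T‖` for all rank-one
bounded operators `T`, i.e. for all `T v = f v • x` with `f` in the dual of `X` and `x` in `X`. -/
def HasDaugavetProperty (X : Type*) [NormedAddCommGroup X] [NormedSpace ℝ X] : Prop :=
  ∀ (f : StrongDual ℝ X) (x : X),
    ‖ContinuousLinearMap.id ℝ X + f.smulRight x‖ = 1 + ‖f.smulRight x‖

end LipFree

end

/-!
All three properties are equivalent to the existence of approximate midpoints in `M`
(`HasApproxMidpoints`). For complete `M` this is the property of being a length space: passing to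
the limit of dyadic subdivisions gives almost geodesic Lipschitz curves, and among the curves
inside the compact image of such a curve one with the least Lipschitz constant exists by
Tychonoff's theorem and is injective, because a loop could be cut out (`exists_injOn_curve`).

If `p` and `q` have no approximate midpoint, the difference of two tent functions around `p` and
`q` is a Lipschitz function `f` such that all pairs of points at which `f` is steep are far apart.
A steep pair `(u, v)` of almost minimal length can then be singled out by adding to `f` a large
multiple of a function that peaks at `(u, v)`: the steep pairs of the sum lie almost between `u`
and `v` and are not shorter than `(u, v)`, so they are close to `(u, v)`. Since the unit ball is
the closed convex hull of the molecules, it has a slice of small diameter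
(`IsLipschitzFree.hasSmallSlice`), which neither a locally almost square space nor a space with
the Daugavet property has.

Conversely, if `M` has approximate midpoints, then each `1`-Lipschitz function is uniformly close
to a `1`-Lipschitz function that zigzags with slopes `±1` along some almost geodesic chain from
`a` to `b`. This splits `δ_a - δ_b` into an ascending part `P` and a descending part `Q` of total
norm about `d(a, b)`, both normed by the new function (`IsLipschitzFree.exists_splitting`). If the
function is uniformly small, the two parts have norm about `d(a, b) / 2`, so that `(P - Q) / d(a,
b)` witnesses local almost squareness at the molecule of `(a, b)`; because the changes of the
function are as small as desired, finitely many molecules can be treated one after the other. If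
the function norms a given `x` and the molecule of `(a, b)` norms a given functional `φ`, then
`P`, normalised, almost norms `φ` and is almost at distance `‖x‖ + 1` from `-x`, which gives the
Daugavet equation.
-/

open Filter Topology Set

namespace LipFree

/-! ### Approximate midpoints, short curves and length spaces -/

/-- `M` has approximate midpoints: points at distance less than `r` have a common point at distance
less than `r / 2` from both. -/
def HasApproxMidpoints (M : Type*) [MetricSpace M] : Prop :=
  ∀ (p q : M) (r : ℝ), dist p q < r → ∃ z, dist p z < r / 2 ∧ dist z q < r / 2

section Metric

variable {M : Type*} [MetricSpace M]

theorem dist_le_mul_of_dist_succ_le {X : Type*} [PseudoMetricSpace X] {c : ℕ → X} {h : ℝ}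
    (hc : ∀ k, dist (c k) (c (k + 1)) ≤ h) (i j : ℕ) :
    dist (c i) (c j) ≤ h * |(i : ℝ) - j| := by
  wlog hij : i ≤ j generalizing i j
  · rw [dist_comm, abs_sub_comm]
    exact this j i (le_of_not_ge hij)
  have h1 := dist_le_Ico_sum_of_dist_le (f := c) hij (d := fun _ => h) (fun _ _ => hc _)
  have h2 : (i : ℝ) ≤ j := by exact_mod_cast hij
  rw [abs_sub_comm, abs_of_nonneg (sub_nonneg.2 h2)]
  simpa [Nat.cast_sub hij, mul_comm] using h1

theorem abs_natFloor_sub_natFloor_le (a b : ℝ) : |(⌊a⌋₊ : ℝ) - ⌊b⌋₊| ≤ |a - b| + 1 := by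
  wlog hab : a ≤ b generalizing a b
  · rw [abs_sub_comm, abs_sub_comm a b]
    exact this b a (le_of_not_ge hab)
  have h1 : (⌊a⌋₊ : ℝ) ≤ ⌊b⌋₊ := by exact_mod_cast Nat.floor_mono hab
  rw [abs_sub_comm, abs_of_nonneg (sub_nonneg.2 h1), abs_sub_comm,
    abs_of_nonneg (sub_nonneg.2 hab)]
  have h2 := Nat.lt_floor_add_one a
  rcases le_or_gt 0 b with hb | hb
  · linarith [Nat.floor_le hb]
  · rw [Nat.floor_of_nonpos hb.le, Nat.floor_of_nonpos (hab.trans hb.le)]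
    simp; linarith

/-- Inserting approximate midpoints between consecutive points of a sequence. -/
def refineSeq (mid : M → M → M) (c : ℕ → M) (k : ℕ) : M :=
  if Even k then c (k / 2) else mid (c (k / 2)) (c (k / 2 + 1))

/-- In a complete space with approximate midpoints, points at distance less than `L` are joined by
an `L`-Lipschitz curve: the limit of the step functions that run through the dyadic subdivisions. -/
theorem HasApproxMidpoints.exists_lipschitz_curve [CompleteSpace M] (hM : HasApproxMidpoints M)
    {p q : M} {L : ℝ} (hL : dist p q < L) :
    ∃ γ : ℝ → M, (∀ s t, dist (γ s) (γ t) ≤ L * |s - t|) ∧ γ 0 = p ∧ γ 1 = q := by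
  have hL0 : 0 < L := dist_nonneg.trans_lt hL
  choose! mid' hmid1 hmid2 using hM
  -- The points of the `n`-th subdivision.
  let c : ℕ → ℕ → M := fun n => n.rec (fun k => if k = 0 then p else q)
    (fun n c => refineSeq (fun a b => mid' a b (L / 2 ^ n)) c)
  have hc0 : ∀ k, c 0 k = if k = 0 then p else q := fun _ => rfl
  have hcs : ∀ n k, c (n + 1) k = refineSeq (fun a b => mid' a b (L / 2 ^ n)) (c n) k :=
    fun _ _ => rfl
  have hE : ∀ n k, c (n + 1) (2 * k) = c n k := fun n k => by simp [hcs, refineSeq]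
  have hO : ∀ n k, c (n + 1) (2 * k + 1) = mid' (c n k) (c n (k + 1)) (L / 2 ^ n) := fun n k => by
    have : (2 * k + 1) / 2 = k := by omega
    simp [hcs, refineSeq, this]
  have hd : ∀ n k, dist (c n k) (c n (k + 1)) < L / 2 ^ n := by
    intro n
    induction n with
    | zero => intro k; rcases k with _ | k <;> simp [hc0, hL, hL0]
    | succ n ih =>
      intro k
      have e : L / 2 ^ (n + 1) = L / 2 ^ n / 2 := by rw [pow_succ, div_mul_eq_div_div]
      rcases Nat.even_or_odd' k with ⟨j, rfl | rfl⟩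
      · rw [hE, hO, e]; exact hmid1 _ _ _ (ih j)
      · rw [hO, show 2 * j + 1 + 1 = 2 * (j + 1) by ring, hE, e]; exact hmid2 _ _ _ (ih j)
  let g : ℕ → ℝ → M := fun n t => c n ⌊t * 2 ^ n⌋₊
  have hg : ∀ t n, dist (g n t) (g (n + 1) t) ≤ L / 2 / 2 ^ n := by
    intro t n
    have e : ⌊t * 2 ^ n⌋₊ = ⌊t * 2 ^ (n + 1)⌋₊ / 2 := by
      have h := Nat.floor_div_natCast (t * 2 ^ (n + 1)) 2
      rw [← h]; congr 1; push_cast; ring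
    have e' : L / 2 ^ n / 2 = L / 2 / 2 ^ n := by ring
    simp only [g]
    rw [e]
    generalize ⌊t * 2 ^ (n + 1)⌋₊ = k
    rcases Nat.even_or_odd' k with ⟨j, rfl | rfl⟩
    · rw [hE, show 2 * j / 2 = j by omega, dist_self]; positivity
    · rw [hO, show (2 * j + 1) / 2 = j by omega, ← e']; exact (hmid1 _ _ _ (hd n j)).le
  have hlim : ∀ t, ∃ a, Tendsto (fun n => g n t) atTop (𝓝 a) := fun t =>
    cauchySeq_tendsto_of_complete (cauchySeq_of_le_geometric_two (hg t))
  choose γ hγ using hlim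
  have hfix : ∀ t a, (∀ n, g n t = a) → γ t = a := fun t a h =>
    tendsto_nhds_unique (hγ t) (by simp only [h]; exact tendsto_const_nhds)
  refine ⟨γ, fun s t => ?_, hfix 0 p fun n => ?_, hfix 1 q fun n => ?_⟩
  · have hb : ∀ n, dist (g n s) (g n t) ≤ L * |s - t| + L * (1 / 2) ^ n := by
      intro n
      refine (dist_le_mul_of_dist_succ_le (fun k => (hd n k).le) _ _).trans ?_
      have h1 := abs_natFloor_sub_natFloor_le (s * 2 ^ n) (t * 2 ^ n)
      rw [← sub_mul, abs_mul, abs_of_pos (by positivity : (0 : ℝ) < 2 ^ n)] at h1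
      refine (mul_le_mul_of_nonneg_left h1 (by positivity)).trans (le_of_eq ?_)
      rw [one_div, inv_pow]
      field_simp
    have ht : Tendsto (fun n : ℕ => L * |s - t| + L * (1 / 2 : ℝ) ^ n) atTop
        (𝓝 (L * |s - t| + L * 0)) :=
      (tendsto_pow_atTop_nhds_zero_of_lt_one (by norm_num) (by norm_num)).const_mul L
        |>.const_add _
    have := le_of_tendsto_of_tendsto' ((hγ s).dist (hγ t)) ht hb
    simpa using this
  · simp only [g, zero_mul, Nat.floor_zero]
    induction n with
    | zero => simp [hc0]
    | succ n ih => rw [show 0 = 2 * 0 by rfl, hE]; exact ih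
  · have : ∀ n : ℕ, ⌊(1 : ℝ) * 2 ^ n⌋₊ = 2 ^ n := fun n => by
      rw [one_mul]; exact_mod_cast Nat.floor_natCast (2 ^ n)
    simp only [g, this]
    induction n with
    | zero => simp [hc0]
    | succ n ih => rw [pow_succ', hE]; exact ih

/-- Cutting out a loop of a Lipschitz curve and rescaling gives a curve with a smaller Lipschitz
constant. -/
theorem exists_curve_of_loop {F : ℝ → M} {L : ℝ} (hF : ∀ s t, dist (F s) (F t) ≤ L * |s - t|)
    {s t : ℝ} (hs : 0 ≤ s) (ht : t ≤ 1) (h : F s = F t) :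
    ∃ G : ℝ → M, (∀ u v, dist (G u) (G v) ≤ L * (1 - (t - s)) * |u - v|) ∧ G 0 = F 0 ∧
      G 1 = F 1 ∧ range G ⊆ range F := by
  have hd : 0 ≤ 1 - (t - s) := by linarith
  have hL : 0 ≤ L := by simpa using dist_nonneg.trans (hF 0 1)
  refine ⟨fun u => if u * (1 - (t - s)) ≤ s then F (u * (1 - (t - s)))
    else F (u * (1 - (t - s)) + (t - s)), fun u v => ?_, by simp [hs], ?_, ?_⟩
  · wlog huv : u ≤ v generalizing u v
    · rw [dist_comm, abs_sub_comm]
      exact this v u (le_of_not_ge huv)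
    have hm : u * (1 - (t - s)) ≤ v * (1 - (t - s)) := mul_le_mul_of_nonneg_right huv hd
    rw [abs_sub_comm, abs_of_nonneg (sub_nonneg.2 huv)]
    dsimp only
    split_ifs with h1 h2 h2
    · refine (hF _ _).trans (le_of_eq ?_)
      rw [abs_sub_comm, abs_of_nonneg (sub_nonneg.2 hm)]; ring
    · have a1 := hF (u * (1 - (t - s))) s
      have a2 := hF t (v * (1 - (t - s)) + (t - s))
      rw [abs_sub_comm, abs_of_nonneg (by linarith)] at a1
      rw [abs_sub_comm, abs_of_nonneg (by linarith)] at a2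
      have a3 := dist_triangle (F (u * (1 - (t - s)))) (F s) (F (v * (1 - (t - s)) + (t - s)))
      rw [h] at a3 a1
      nlinarith
    · exact absurd (hm.trans h2) h1
    · refine (hF _ _).trans (le_of_eq ?_)
      rw [abs_sub_comm, abs_of_nonneg (by linarith)]; ring
  · dsimp only
    split_ifs with h1
    · have h3 : t = 1 := by linarith
      rw [one_mul, show 1 - (t - s) = s by linarith, h, h3]
    · congr 1; ring
  · rintro _ ⟨u, rfl⟩
    dsimp only
    split_ifs <;> exact mem_range_self _

/-- Two points joined by an `L₀`-Lipschitz curve are joined by an injective one: among the curves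
in its (compact) image one with the smallest Lipschitz constant has no loops. -/
theorem exists_injOn_curve {p q : M} (hpq : p ≠ q) {L₀ : ℝ} {γ : ℝ → M}
    (hγ : ∀ s t, dist (γ s) (γ t) ≤ L₀ * |s - t|) (h0 : γ 0 = p) (h1 : γ 1 = q) :
    ∃ F : ℝ → M, (∀ s t, dist (F s) (F t) ≤ L₀ * |s - t|) ∧ F 0 = p ∧ F 1 = q ∧
      InjOn F (Icc 0 1) := by
  have hL₀ : 0 ≤ L₀ := by simpa using dist_nonneg.trans (hγ 0 1)
  have hcont : Continuous γ := by
    refine (LipschitzWith.of_dist_le_mul (K := L₀.toNNReal) fun s t => ?_).continuous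
    rw [Real.coe_toNNReal _ hL₀]; exact hγ s t
  let K : Set M := γ '' Icc 0 1
  have hK : IsCompact K := isCompact_Icc.image hcont
  let S : Set (ℝ × (ℝ → M)) := {x | (∀ s t, dist (x.2 s) (x.2 t) ≤ x.1 * |s - t|) ∧
    x.2 0 = p ∧ x.2 1 = q}
  have hev : ∀ t : ℝ, Continuous fun x : ℝ × (ℝ → M) => x.2 t := fun t =>
    (continuous_apply t).comp continuous_snd
  have hS : IsClosed S := by
    have e : S = (⋂ (s : ℝ) (t : ℝ), {x : ℝ × (ℝ → M) | dist (x.2 s) (x.2 t) ≤ x.1 * |s - t|}) ∩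
        ({x | x.2 0 = p} ∩ {x | x.2 1 = q}) := by
      ext x; simp [S]
    rw [e]
    refine IsClosed.inter (isClosed_iInter fun s => isClosed_iInter fun t => ?_)
      (IsClosed.inter ?_ ?_)
    · exact isClosed_le ((hev s).dist (hev t)) (continuous_fst.mul continuous_const)
    · exact isClosed_eq (hev 0) continuous_const
    · exact isClosed_eq (hev 1) continuous_const
  let T : Set (ℝ × (ℝ → M)) := (Icc 0 L₀ ×ˢ univ.pi fun _ => K) ∩ S
  have hT : IsCompact T := (isCompact_Icc.prod (isCompact_univ_pi fun _ => hK)).inter_right hS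
  have hne : T.Nonempty := by
    refine ⟨(L₀, fun t => γ (max 0 (min t 1))), ⟨⟨hL₀, le_rfl⟩, fun t _ => ?_⟩, fun s t => ?_,
      by simp [h0], by simp [h1]⟩
    · exact mem_image_of_mem _ ⟨le_max_left _ _, max_le zero_le_one (min_le_right _ _)⟩
    · refine (hγ _ _).trans (mul_le_mul_of_nonneg_left ?_ hL₀)
      rw [max_comm 0, max_comm 0]
      refine (abs_max_sub_max_le_abs _ _ _).trans ((abs_min_sub_min_le_max _ _ _ _).trans ?_)
      simp
  obtain ⟨⟨L, F⟩, ⟨⟨hL, hFK⟩, hF, hF0, hF1⟩, hmin⟩ := hT.exists_isMinOn hne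
    continuous_fst.continuousOn
  dsimp only at hL hFK hF hF0 hF1
  have hLpos : 0 < L := by
    have := hF 0 1
    rw [hF0, hF1] at this
    simpa using (dist_pos.2 hpq).trans_le this
  have key : ∀ s ∈ Icc (0 : ℝ) 1, ∀ t ∈ Icc (0 : ℝ) 1, s < t → F s ≠ F t := by
    intro s hs t ht hst h
    obtain ⟨G, hG, hG0, hG1, hGF⟩ := exists_curve_of_loop hF hs.1 ht.2 h
    have hm : (L * (1 - (t - s)), G) ∈ T := by
      refine ⟨⟨⟨mul_nonneg hLpos.le (by linarith [hs.1, ht.2]), ?_⟩, fun u _ => ?_⟩,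
        hG, hG0.trans hF0, hG1.trans hF1⟩
      · refine le_trans ?_ hL.2
        dsimp only
        nlinarith
      · obtain ⟨w, hw⟩ := hGF (mem_range_self u)
        dsimp only
        rw [← hw]; exact hFK w (mem_univ w)
    have := hmin hm
    simp only [mem_ofPred_eq] at this
    nlinarith
  refine ⟨F, fun s t => (hF s t).trans (mul_le_mul_of_nonneg_right hL.2 (abs_nonneg _)), hF0, hF1,
    fun s hs t ht h => ?_⟩
  rcases lt_trichotomy s t with hlt | heq | hlt
  · exact absurd h (key s hs t ht hlt)
  · exact heq
  · exact absurd h.symm (key t ht s hs hlt)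

theorem HasApproxMidpoints.isLengthSpace [CompleteSpace M] (hM : HasApproxMidpoints M) :
    IsLengthSpace M := by
  intro p q hpq
  refine le_antisymm ?_ ?_
  · refine le_iInf fun γ => le_iInf fun _ => le_iInf fun _ => ?_
    simpa using eVariationOn.edist_le γ (mem_univ (0 : unitInterval)) (mem_univ (1 : unitInterval))
  · refine le_of_forall_gt fun L hL => ?_
    obtain ⟨L', hL', hL''⟩ := exists_between hL
    have hfin : L' ≠ ⊤ := hL''.ne_top
    have hd : dist p q < L'.toReal := by
      rw [dist_edist]; exact (ENNReal.toReal_lt_toReal (edist_ne_top _ _) hfin).2 hL'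
    obtain ⟨γ, hγ, h0, h1⟩ := hM.exists_lipschitz_curve hd
    obtain ⟨F, hF, hF0, hF1, hinj⟩ := exists_injOn_curve hpq hγ h0 h1
    have hlip : LipschitzWith L'.toNNReal F := LipschitzWith.of_dist_le_mul fun s t => hF s t
    let c : Path p q :=
      { toFun := fun t => F t
        continuous_toFun := hlip.continuous.comp continuous_subtype_val
        source' := by simpa using hF0
        target' := by simpa using hF1 }
    have hc : eVariationOn c univ ≤ L' := by
      have a1 := hlip.lipschitzOnWith.comp_eVariationOn_le
        (g := fun t : unitInterval => (t : ℝ)) (mapsTo_univ _ univ)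
      have a2 : eVariationOn (fun t : unitInterval => (t : ℝ)) univ ≤ 1 := by
        have := (Monotone.monotoneOn (Subtype.mono_coe _) univ :
          MonotoneOn (fun t : unitInterval => (t : ℝ)) univ).eVariationOn_eq
          (mem_univ 0) (mem_univ 1)
        have e : (univ ∩ Icc 0 1 : Set unitInterval) = univ := by
          ext t; exact iff_of_true ⟨trivial, t.2.1, t.2.2⟩ trivial
        rw [e] at this
        simp [this]
      refine a1.trans ((mul_le_mul_right a2 _).trans ?_)
      rw [mul_one, ENNReal.coe_toNNReal hfin]
    refine lt_of_le_of_lt (iInf_le_of_le c (iInf_le_of_le ?_ (iInf_le_of_le ?_ hc))) hL''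
    · intro s t h
      exact Subtype.ext (hinj s.2 t.2 h)
    · exact ne_top_of_le_ne_top hfin hc

theorem IsLengthSpace.hasApproxMidpoints (hM : IsLengthSpace M) : HasApproxMidpoints M := by
  intro p q r hr
  have hr0 : 0 < r := dist_nonneg.trans_lt hr
  rcases eq_or_ne p q with rfl | hpq
  · exact ⟨p, by simpa using hr0, by simpa using hr0⟩
  have h1 : edist p q < ENNReal.ofReal r := by
    rw [edist_dist]; exact (ENNReal.ofReal_lt_ofReal_iff hr0).2 hr
  rw [hM p q hpq] at h1
  simp only [iInf_lt_iff] at h1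
  obtain ⟨γ, -, -, hγ⟩ := h1
  have hsum : ∀ t, dist p (γ t) + dist (γ t) q < r := by
    intro t
    have a1 : edist p (γ t) ≤ eVariationOn γ (Iic t) := by
      simpa using eVariationOn.edist_le γ (show (0 : unitInterval) ∈ Iic t from t.2.1)
        self_mem_Iic
    have a2 : edist (γ t) q ≤ eVariationOn γ (Ici t) := by
      simpa using eVariationOn.edist_le γ self_mem_Ici
        (show (1 : unitInterval) ∈ Ici t from t.2.2)
    have a3 := eVariationOn.add_le_union γ (s := Iic t) (t := Ici t)
      (fun x hx y hy => le_trans hx hy)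
    have a4 := ((add_le_add a1 a2).trans (a3.trans (eVariationOn.mono γ (subset_univ _)))).trans_lt hγ
    rw [edist_dist, edist_dist, ← ENNReal.ofReal_add dist_nonneg dist_nonneg,
      ENNReal.ofReal_lt_ofReal_iff hr0] at a4
    exact a4
  -- A point of the path that is equidistant from its ends.
  obtain ⟨t, ht⟩ := intermediate_value_univ (0 : unitInterval) 1
    (f := fun t => dist p (γ t) - dist (γ t) q) (by fun_prop)
    (show (0 : ℝ) ∈ _ by simp [dist_nonneg])
  dsimp only at ht
  exact ⟨γ t, by linarith [hsum t], by linarith [hsum t]⟩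

end Metric

/-! ### The universal property of the free space, and molecules -/

/-- The universal property of the Lipschitz-free space, for a normed space `X` with a map
`δ : M → X`: `δ` is `1`-Lipschitz with `δ o = 0` and dense span, and each Lipschitz function on `M`
that vanishes at `o` extends to a functional on `X` of no larger norm. It determines
the completion of `X` up to isometry, and the argument uses nothing else about `freeSpace o`. -/
structure IsLipschitzFree {M : Type*} [MetricSpace M] (o : M) {X : Type*} [NormedAddCommGroup X]
    [NormedSpace ℝ X] (δ : M → X) : Prop where
  map_base : δ o = 0
  norm_map_sub_le : ∀ p q, ‖δ p - δ q‖ ≤ dist p q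
  dense_span : Dense (Submodule.span ℝ (range δ) : Set X)
  exists_extension : ∀ (f : M → ℝ) (K : ℝ), 0 ≤ K → (∀ p q, |f p - f q| ≤ K * dist p q) →
    f o = 0 → ∃ φ : StrongDual ℝ X, ‖φ‖ ≤ K ∧ ∀ p, φ (δ p) = f p

section Free

/-- On a finite combination of points `δ p`, functionals that are uniformly close on the points
`δ p` take close values. -/
theorem exists_abs_apply_sub_le {ι X : Type*} [Nonempty ι] [NormedAddCommGroup X]
    [NormedSpace ℝ X] {δ : ι → X} {x : X} (hx : x ∈ Submodule.span ℝ (range δ)) :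
    ∃ C : ℝ, 0 < C ∧ ∀ (φ ψ : StrongDual ℝ X) (ρ : ℝ), (∀ p, |φ (δ p) - ψ (δ p)| ≤ ρ) →
      |φ x - ψ x| ≤ C * ρ := by
  have hpos : ∀ (φ ψ : StrongDual ℝ X) (ρ : ℝ), (∀ p, |φ (δ p) - ψ (δ p)| ≤ ρ) → 0 ≤ ρ :=
    fun φ ψ ρ h => (abs_nonneg _).trans (h (Classical.arbitrary ι))
  induction hx using Submodule.span_induction with
  | mem x h =>
    obtain ⟨p, rfl⟩ := h
    exact ⟨1, one_pos, fun f g ρ h => by rw [one_mul]; exact h p⟩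
  | zero => exact ⟨1, one_pos, fun f g ρ h => by simpa using hpos f g ρ h⟩
  | add x y _ _ hx hy =>
    obtain ⟨C, hC, hx⟩ := hx
    obtain ⟨D, hD, hy⟩ := hy
    refine ⟨C + D, by positivity, fun f g ρ h => ?_⟩
    rw [map_add, map_add, add_sub_add_comm, add_mul]
    exact (abs_add_le _ _).trans (add_le_add (hx f g ρ h) (hy f g ρ h))
  | smul c x _ hx =>
    obtain ⟨C, hC, hx⟩ := hx
    refine ⟨(|c| + 1) * C, by positivity, fun f g ρ h => ?_⟩
    rw [map_smul, map_smul, ← smul_sub, smul_eq_mul, abs_mul, mul_assoc]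
    exact mul_le_mul (by linarith) (hx f g ρ h) (abs_nonneg _) (by positivity)

variable {M : Type*} [MetricSpace M] {o : M} {X : Type*} [NormedAddCommGroup X] [NormedSpace ℝ X]
  {δ : M → X}

theorem apply_le_norm {φ : StrongDual ℝ X} (hφ : ‖φ‖ ≤ 1) (x : X) : φ x ≤ ‖x‖ :=
  (le_abs_self _).trans ((φ.le_opNorm x).trans (mul_le_of_le_one_left (norm_nonneg _) hφ))

theorem IsLipschitzFree.abs_sub_le (hX : IsLipschitzFree o δ) (φ : StrongDual ℝ X) (p q : M) :
    |φ (δ p) - φ (δ q)| ≤ ‖φ‖ * dist p q := by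
  rw [← map_sub]
  exact (φ.le_opNorm _).trans (mul_le_mul_of_nonneg_left (hX.norm_map_sub_le p q) (norm_nonneg _))

/-- The extension property for functions that need not vanish at the base point. -/
theorem IsLipschitzFree.exists_functional (hX : IsLipschitzFree o δ) {f : M → ℝ} {K : ℝ}
    (hK : 0 ≤ K) (hf : ∀ p q, |f p - f q| ≤ K * dist p q) :
    ∃ φ : StrongDual ℝ X, ‖φ‖ ≤ K ∧ ∀ p, φ (δ p) = f p - f o :=
  hX.exists_extension (fun p => f p - f o) K hK
    (fun p q => by rw [sub_sub_sub_cancel_right]; exact hf p q) (sub_self _)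

/-- The molecule `(δ p - δ q) / d(p, q)`; it is `0` for `p = q`. -/
noncomputable def molecule (δ : M → X) (p q : M) : X := (dist p q)⁻¹ • (δ p - δ q)

theorem apply_molecule (φ : StrongDual ℝ X) (p q : M) :
    φ (molecule δ p q) = (φ (δ p) - φ (δ q)) / dist p q := by
  rw [molecule, map_smul, map_sub, smul_eq_mul, div_eq_inv_mul]

theorem IsLipschitzFree.norm_molecule_le (hX : IsLipschitzFree o δ) (p q : M) :
    ‖molecule δ p q‖ ≤ 1 := by
  rw [molecule, norm_smul, norm_inv, Real.norm_of_nonneg dist_nonneg]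
  exact (mul_le_mul_of_nonneg_left (hX.norm_map_sub_le p q) (inv_nonneg.2 dist_nonneg)).trans
    inv_mul_le_one

theorem IsLipschitzFree.norm_molecule (hX : IsLipschitzFree o δ) {p q : M} (h : p ≠ q) :
    ‖molecule δ p q‖ = 1 := by
  refine le_antisymm (hX.norm_molecule_le p q) ?_
  obtain ⟨φ, hφ, hφ'⟩ := hX.exists_functional (f := fun a => dist a q) zero_le_one
    fun a b => by rw [one_mul]; exact abs_dist_sub_le a b q
  have h1 := apply_le_norm hφ (molecule δ p q)
  rwa [apply_molecule, hφ', hφ', sub_sub_sub_cancel_right, dist_self, sub_zero,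
    div_self (dist_pos.2 h).ne'] at h1

/-- The unit ball of the free space is the closed convex hull of the molecules. -/
theorem IsLipschitzFree.mem_of_molecule_mem (hX : IsLipschitzFree o δ) [Nontrivial M] {S : Set X}
    (hc : Convex ℝ S) (hcl : IsClosed S) (hS : ∀ p q : M, p ≠ q → molecule δ p q ∈ S) {x : X}
    (hx : ‖x‖ ≤ 1) : x ∈ S := by
  by_contra hn
  obtain ⟨φ, u, h1, h2⟩ := geometric_hahn_banach_closed_point hc hcl hn
  obtain ⟨a, b, hab⟩ := exists_pair_ne M
  have hb : ∀ p q : M, |φ (δ p) - φ (δ q)| ≤ u * dist p q := by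
    intro p q
    rcases eq_or_ne p q with rfl | hpq
    · simp
    have hd := dist_pos.2 hpq
    have e1 := h1 _ (hS p q hpq)
    have e2 := h1 _ (hS q p hpq.symm)
    rw [apply_molecule, div_lt_iff₀ hd] at e1
    rw [apply_molecule, dist_comm, div_lt_iff₀ hd] at e2
    exact abs_le.2 ⟨by linarith, by linarith⟩
  have hu : 0 ≤ u := nonneg_of_mul_nonneg_left ((abs_nonneg _).trans (hb a b)) (dist_pos.2 hab)
  obtain ⟨ψ, hψ, hψ'⟩ := hX.exists_extension (fun p => φ (δ p)) u hu hb (by simp [hX.map_base])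
  have e : ψ = φ := ContinuousLinearMap.ext_on hX.dense_span (by
    rintro _ ⟨p, rfl⟩; exact hψ' p)
  subst e
  have h3 := (le_abs_self _).trans (ψ.le_opNorm x)
  nlinarith [norm_nonneg x, norm_nonneg ψ]

/-- Molecules are norming for the functionals on the free space. -/
theorem IsLipschitzFree.exists_lt_apply_molecule (hX : IsLipschitzFree o δ) [Nontrivial M]
    (φ : StrongDual ℝ X) {r : ℝ} (hr : r < ‖φ‖) :
    ∃ p q : M, p ≠ q ∧ r < φ (molecule δ p q) := by
  by_contra! hn
  have hb : ∀ x : X, ‖x‖ ≤ 1 → φ x ≤ r := fun x hx =>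
    hX.mem_of_molecule_mem (S := {x | φ x ≤ r}) (convex_halfSpace_le φ.toLinearMap.isLinear r)
      (isClosed_le φ.continuous continuous_const) hn hx
  obtain ⟨x, hx, h⟩ := φ.exists_lt_apply_of_lt_opNorm hr
  rcases abs_cases (φ x) with h' | h' <;> rw [Real.norm_eq_abs, h'.1] at h
  · linarith [hb x hx.le]
  · have := hb (-x) (by rw [norm_neg]; exact hx.le)
    rw [map_neg] at this
    linarith

end Free

/-! ### The free space has the universal property -/

section Concrete

variable {M : Type*} [MetricSpace M] {o : M}

theorem delta_mem_freeSpace (o p : M) : delta o p ∈ freeSpace o :=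
  subset_closure (Submodule.subset_span (mem_range_self p))

theorem isLipschitzFree_freeSpace (o : M) :
    IsLipschitzFree o (fun p => (⟨delta o p, delta_mem_freeSpace o p⟩ : freeSpace o)) where
  map_base := Subtype.ext (ContinuousLinearMap.ext fun f => f.apply_base)
  norm_map_sub_le p q := by
    refine ContinuousLinearMap.opNorm_le_bound _ dist_nonneg fun f => ?_
    have := f.abs_sub_le p q
    rwa [mul_comm] at this
  dense_span := by
    rw [dense_iff_closure_eq, eq_univ_iff_forall]
    intro x
    rw [closure_subtype]
    refine closure_mono ?_ x.2
    intro y hy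
    have hmap : (Submodule.span ℝ (range fun p =>
        (⟨delta o p, delta_mem_freeSpace o p⟩ : freeSpace o))).map (freeSpace o).subtype =
        Submodule.span ℝ (range (delta o)) := by
      rw [Submodule.map_span, ← range_comp]; rfl
    rw [← hmap] at hy
    exact hy
  exists_extension f K hK hf hfo := by
    let F : Lip0 o := ⟨f, ⟨K.toNNReal, LipschitzWith.of_dist_le_mul fun p q => by
      rw [Real.dist_eq, Real.coe_toNNReal _ hK]; exact hf p q⟩, hfo⟩
    have hF : ‖F‖ ≤ K := F.norm_le hK hf
    refine ⟨LinearMap.mkContinuous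
      { toFun := fun μ : freeSpace o => μ.1 F
        map_add' := fun _ _ => rfl
        map_smul' := fun _ _ => rfl } K fun μ => ?_, ?_, fun p => rfl⟩
    · refine (μ.1.le_opNorm F).trans ?_
      rw [mul_comm]
      exact mul_le_mul_of_nonneg_right hF (norm_nonneg _)
    · exact LinearMap.mkContinuous_norm_le _ hK _

end Concrete

/-! ### Slices of small diameter -/

/-- The unit ball of `X` has a slice of small diameter: the points `x` of the ball at which `φ` is
almost `‖φ‖` are almost within `1 / 4` of `m`. The bound holds on the whole ball, so that it can be
checked on any set with the ball as its closed convex hull. -/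
def HasSmallSlice (X : Type*) [NormedAddCommGroup X] [NormedSpace ℝ X] : Prop :=
  ∃ (φ : StrongDual ℝ X) (m : X) (C : ℝ), 0 ≤ C ∧ ‖m‖ = 1 ∧
    ∀ x, ‖x‖ ≤ 1 → ‖x - m‖ ≤ 1 / 4 + C * (‖φ‖ - φ x)

section Abstract

variable {X : Type*} [NormedAddCommGroup X] [NormedSpace ℝ X]

theorem exists_norm_lt_one_lt_apply (φ : StrongDual ℝ X) {r : ℝ} (hr : r < ‖φ‖) :
    ∃ x, ‖x‖ < 1 ∧ r < φ x := by
  obtain ⟨x, hx, h⟩ := φ.exists_lt_apply_of_lt_opNorm hr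
  rcases abs_cases (φ x) with h' | h' <;> rw [Real.norm_eq_abs, h'.1] at h
  · exact ⟨x, hx, h⟩
  · exact ⟨-x, by rwa [norm_neg], by rwa [map_neg]⟩

theorem exists_norm_eq_one_lt_apply (φ : StrongDual ℝ X) {r : ℝ} (hr0 : 0 ≤ r) (hr : r < ‖φ‖) :
    ∃ x, ‖x‖ = 1 ∧ r < φ x := by
  obtain ⟨x, hx, h⟩ := exists_norm_lt_one_lt_apply φ hr
  have hx0 : x ≠ 0 := by rintro rfl; rw [map_zero] at h; linarith
  have hxp := norm_pos_iff.2 hx0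
  refine ⟨‖x‖⁻¹ • x, by rw [norm_smul, norm_inv, norm_norm, inv_mul_cancel₀ hxp.ne'], ?_⟩
  rw [map_smul, smul_eq_mul, ← div_eq_inv_mul, lt_div_iff₀ hxp]
  nlinarith

/-- The functional of a small slice is not zero: the ball contains `-m`. -/
theorem norm_pos_of_smallSlice {φ : StrongDual ℝ X} {m : X} {C : ℝ} (hm : ‖m‖ = 1)
    (h : ∀ x, ‖x‖ ≤ 1 → ‖x - m‖ ≤ 1 / 4 + C * (‖φ‖ - φ x)) : 0 < ‖φ‖ := by
  refine norm_pos_iff.2 fun h0 => ?_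
  have h1 := h (-m) (by rw [norm_neg, hm])
  have h2 : ‖-m - m‖ = 2 := by
    rw [← neg_add', norm_neg, ← two_smul ℝ m, norm_smul, hm]; norm_num
  rw [h2, h0] at h1
  norm_num at h1

/-- If `x` lies deep inside a slice and `‖x ± y‖ ≤ 1 + σ`, then `x ± y` almost lie in this slice,
while their distance is `2 ‖y‖`. -/
theorem HasSmallSlice.not_isLASQ (hX : HasSmallSlice X) : ¬ IsLASQ X := by
  rintro hL
  obtain ⟨φ, m, C, hC, hm, h⟩ := hX
  have hφ := norm_pos_of_smallSlice hm h
  let σ := min (1 / 4) (min (‖φ‖ / 2) (1 / (8 * (C + 1) * (‖φ‖ + 1))))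
  have hσ : 0 < σ := by positivity
  have hσ1 : σ ≤ 1 / 4 := min_le_left _ _
  have hσ2 : σ ≤ ‖φ‖ / 2 := (min_le_right _ _).trans (min_le_left _ _)
  have hσ3 : σ * (8 * (C + 1) * (‖φ‖ + 1)) ≤ 1 :=
    (le_div_iff₀ (by positivity)).1 ((min_le_right _ _).trans (min_le_right _ _))
  obtain ⟨x, hx, hφx⟩ := exists_norm_eq_one_lt_apply φ (r := ‖φ‖ - σ) (by linarith) (by linarith)
  obtain ⟨y, hy, h1, h2⟩ := hL σ hσ x hx
  have hs : (0 : ℝ) < 1 + σ := by positivity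
  have hball : ∀ z : X, ‖z‖ ≤ 1 + σ →
      ‖z - (1 + σ) • m‖ ≤ (1 + σ) / 4 + C * ((1 + σ) * ‖φ‖ - φ z) := by
    intro z hz
    have h3 := h ((1 + σ)⁻¹ • z) (by
      rw [norm_smul, norm_inv, Real.norm_of_nonneg hs.le, inv_mul_le_iff₀ hs, mul_one]
      exact hz)
    have e : z - (1 + σ) • m = (1 + σ) • ((1 + σ)⁻¹ • z - m) := by
      rw [smul_sub, smul_inv_smul₀ hs.ne']
    rw [e, norm_smul, Real.norm_of_nonneg hs.le]
    refine (mul_le_mul_of_nonneg_left h3 hs.le).trans (le_of_eq ?_)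
    rw [map_smul, smul_eq_mul]
    field_simp
  have h3 := hball _ h1
  have h4 := hball _ h2
  have h5 : ‖(x + y) - (x - y)‖ = 2 := by
    rw [add_sub_sub_cancel, ← two_smul ℝ y, norm_smul, hy]; norm_num
  have h6 := norm_sub_le (x + y - (1 + σ) • m) (x - y - (1 + σ) • m)
  rw [sub_sub_sub_cancel_right, h5] at h6
  rw [map_add] at h3
  rw [map_sub] at h4
  have h7 : C * (2 * ((1 + σ) * ‖φ‖) - 2 * φ x) ≤ C * (2 * σ * (‖φ‖ + 1)) :=
    mul_le_mul_of_nonneg_left (by linarith) hC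
  have h8 : 0 < σ * (‖φ‖ + 1) := by positivity
  nlinarith

/-- For `T x = -(φ x / ‖φ‖) m` a vector `u` with `‖u + T u‖` almost `2` lies, up to its sign, in
the slice, so that `u + T u` is small. -/
theorem HasSmallSlice.not_hasDaugavetProperty (hX : HasSmallSlice X) :
    ¬ HasDaugavetProperty X := by
  rintro hD
  obtain ⟨φ, m, C, hC, hm, h⟩ := hX
  have hφ := norm_pos_of_smallSlice hm h
  have h1 := hD (-(‖φ‖⁻¹ • φ)) m
  rw [ContinuousLinearMap.norm_smulRight_apply, norm_neg, norm_smul, norm_inv, norm_norm,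
    inv_mul_cancel₀ hφ.ne', hm] at h1
  let σ := min (1 / 4) (1 / (4 * (C + 1) * ‖φ‖))
  have hσ : 0 < σ := by positivity
  have hσ1 : σ ≤ 1 / 4 := min_le_left _ _
  have hσ2 : σ * (4 * (C + 1) * ‖φ‖) ≤ 1 :=
    (le_div_iff₀ (by positivity)).1 (min_le_right _ _)
  obtain ⟨u, hu, h2⟩ := ContinuousLinearMap.exists_lt_apply_of_lt_opNorm
    (ContinuousLinearMap.id ℝ X + (-(‖φ‖⁻¹ • φ)).smulRight m) (r := 2 - σ) (by linarith)
  have key : ∀ u : X, ‖u‖ < 1 → 0 ≤ φ u → 2 - σ < ‖u - (‖φ‖⁻¹ * φ u) • m‖ → False := by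
    intro u hu hu0 h2
    obtain ⟨a, ha⟩ : ∃ a, a = ‖φ‖⁻¹ * φ u := ⟨_, rfl⟩
    rw [← ha] at h2
    have ha0 : 0 ≤ a := by rw [ha]; positivity
    have hau : φ u = a * ‖φ‖ := by rw [ha]; field_simp
    have ha1 : a ≤ 1 := by
      have := (le_abs_self _).trans (φ.le_opNorm u)
      rw [hau] at this
      nlinarith
    have h3 := norm_sub_le u (a • m)
    rw [norm_smul, hm, Real.norm_of_nonneg ha0] at h3
    have h4 := h u hu.le
    have h5 : u - a • m = (u - m) + (1 - a) • m := by rw [sub_smul, one_smul]; abel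
    have h6 := norm_add_le (u - m) ((1 - a) • m)
    rw [← h5, norm_smul, hm, Real.norm_of_nonneg (sub_nonneg.2 ha1)] at h6
    have h7 : C * (‖φ‖ - φ u) ≤ C * (σ * ‖φ‖) :=
      mul_le_mul_of_nonneg_left (by rw [hau]; nlinarith) hC
    have h8 : 0 < σ * ‖φ‖ := by positivity
    nlinarith
  have e : (ContinuousLinearMap.id ℝ X + (-(‖φ‖⁻¹ • φ)).smulRight m) u =
      u - (‖φ‖⁻¹ * φ u) • m := by
    simp [sub_eq_add_neg]
  rw [e] at h2
  rcases le_total 0 (φ u) with h0 | h0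
  · exact key u hu h0 h2
  · refine key (-u) (by rwa [norm_neg]) (by rw [map_neg]; linarith) ?_
    rwa [map_neg, mul_neg, neg_smul, ← neg_sub', norm_neg]

end Abstract

section Slice

variable {M : Type*} [MetricSpace M]

/-- If `p` and `q` have no approximate midpoint, then the difference of two tents over disjoint
balls around `p` and `q` has slope greater than `1` at the pair `(p, q)`, and only at pairs of points
that are not close to each other. -/
theorem exists_nonlocal_function (hM : ¬ HasApproxMidpoints M) :
    ∃ (f : M → ℝ) (p q : M) (r : ℝ), (∀ a b, |f a - f b| ≤ 2 * dist a b) ∧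
      dist p q < f p - f q ∧ 0 < r ∧ ∀ u v, dist u v < f u - f v → r ≤ dist u v := by
  unfold HasApproxMidpoints at hM
  push Not at hM
  obtain ⟨p, q, r, hr, hz⟩ := hM
  have hr0 : 0 < r := dist_nonneg.trans_lt hr
  have hd : r / 2 ≤ dist p q := hz p (by rw [dist_self]; linarith)
  obtain ⟨e, he⟩ : ∃ e, e = (r + dist p q) / 4 := ⟨_, rfl⟩
  let A : M → ℝ := fun z => max (e - dist p z) 0
  let B : M → ℝ := fun z => max (e - dist z q) 0
  have hA : ∀ a b, |A a - A b| ≤ dist a b := fun a b => by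
    refine (abs_max_sub_max_le_abs _ _ _).trans ?_
    rw [sub_sub_sub_cancel_left, abs_sub_comm, dist_comm p, dist_comm p]
    exact abs_dist_sub_le a b p
  have hB : ∀ a b, |B a - B b| ≤ dist a b := fun a b => by
    refine (abs_max_sub_max_le_abs _ _ _).trans ?_
    rw [sub_sub_sub_cancel_left, abs_sub_comm]
    exact abs_dist_sub_le a b q
  refine ⟨fun z => A z - B z, p, q, r / 2 - e, fun a b => ?_, ?_, by linarith, fun u v h => ?_⟩
  · rw [sub_sub_sub_comm, two_mul]
    exact (abs_sub _ _).trans (add_le_add (hA a b) (hB a b))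
  · have h1 : A p = e := by simp only [A, dist_self, sub_zero]; exact max_eq_left (by linarith)
    have h2 : A q = 0 := max_eq_right (by linarith)
    have h3 : B p = 0 := max_eq_right (by linarith)
    have h4 : B q = e := by simp only [B, dist_self, sub_zero]; exact max_eq_left (by linarith)
    simp only [h1, h2, h3, h4]
    linarith
  · have h1 := (le_abs_self _).trans (hA u v)
    have h2 := (neg_le_abs _).trans (hB u v)
    have h3 : 0 ≤ A v := le_max_right _ _
    have h4 : 0 ≤ B u := le_max_right _ _
    have h5 : 0 < A u := by linarith
    have h6 : 0 < B v := by linarith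
    have h7 : dist p u < e := by
      by_contra! hc
      exact h5.ne' (max_eq_right (by linarith))
    have h8 : dist v q < e := by
      by_contra! hc
      exact h6.ne' (max_eq_right (by linarith))
    have h9 : r / 2 ≤ dist p v := by
      by_contra! hc
      linarith [hz v hc]
    linarith [dist_triangle p u v]

/-- The function `z ↦ (D / 2) (d(z, v) - d(z, u)) / (d(z, v) + d(z, u))` with `D = d(u, v)` has slope
`1` at `(u, v)`; a pair `(a, b)` of almost the same slope lies almost metrically between `u` and
`v`, in this order. -/
theorem exists_peaking_function {u v : M} (huv : u ≠ v) :
    ∃ h : M → ℝ, (∀ a b, |h a - h b| ≤ dist a b) ∧ h u - h v = dist u v ∧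
      ∀ (c : ℝ) (a b : M), a ≠ b → c * dist a b < h a - h b →
        c * (dist a u + dist a b + dist b v) ≤ dist u v := by
  have hD := dist_pos.2 huv
  obtain ⟨D, hDdef⟩ : ∃ D, D = dist u v := ⟨_, rfl⟩
  rw [← hDdef] at hD ⊢
  have hs : ∀ z, D ≤ dist z v + dist z u := fun z => by
    rw [hDdef, add_comm, dist_comm z u]; exact dist_triangle u z v
  have hs0 : ∀ z, 0 < dist z v + dist z u := fun z => hD.trans_le (hs z)
  let h : M → ℝ := fun z => D / 2 * ((dist z v - dist z u) / (dist z v + dist z u))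
  have hdiff : ∀ a b, h a - h b = D * (dist b u * dist a v - dist a u * dist b v) /
      ((dist a v + dist a u) * (dist b v + dist b u)) := fun a b => by
    have h1 := (hs0 a).ne'
    have h2 := (hs0 b).ne'
    simp only [h]
    field_simp
    ring
  -- Both estimates of the numerator come from the triangle inequality.
  have hle : ∀ a b, h a - h b ≤ D * dist a b / (dist a v + dist a u) ∧
      h a - h b ≤ D * dist a b / (dist b v + dist b u) := fun a b => by
    have t1 := dist_triangle a b v
    have t2 := dist_triangle b a u
    rw [dist_comm b a] at t2
    have n1 : 0 ≤ dist a u := dist_nonneg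
    have n2 : 0 ≤ dist a v := dist_nonneg
    have n3 : 0 ≤ dist b u := dist_nonneg
    have n4 : 0 ≤ dist b v := dist_nonneg
    rw [hdiff]
    constructor
    · rw [div_le_div_iff₀ (mul_pos (hs0 a) (hs0 b)) (hs0 a)]
      have : dist b u * dist a v - dist a u * dist b v ≤ dist a b * (dist b v + dist b u) := by
        nlinarith
      have := mul_le_mul_of_nonneg_left this (mul_pos hD (hs0 a)).le
      linarith
    · rw [div_le_div_iff₀ (mul_pos (hs0 a) (hs0 b)) (hs0 b)]
      have : dist b u * dist a v - dist a u * dist b v ≤ dist a b * (dist a v + dist a u) := by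
        nlinarith
      have := mul_le_mul_of_nonneg_left this (mul_pos hD (hs0 b)).le
      linarith
  have hlip : ∀ a b, h a - h b ≤ dist a b := fun a b => by
    refine (hle a b).1.trans ((div_le_iff₀ (hs0 a)).2 ?_)
    rw [mul_comm]
    exact mul_le_mul_of_nonneg_left (hs a) dist_nonneg
  refine ⟨h, fun a b => abs_le.2 ⟨?_, hlip a b⟩, ?_, fun c a b hab hc => ?_⟩
  · have := hlip b a
    rw [dist_comm] at this
    linarith
  · simp only [h, dist_self, dist_comm v u, ← hDdef]
    field_simp
    ring
  · have hd := dist_pos.2 hab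
    have h1 : c * (dist a v + dist a u) < D := by
      have := hc.trans_le (hle a b).1
      rw [lt_div_iff₀ (hs0 a)] at this
      nlinarith
    have h2 : c * (dist b v + dist b u) < D := by
      have := hc.trans_le (hle a b).2
      rw [lt_div_iff₀ (hs0 b)] at this
      nlinarith
    have h3 : h a ≤ D / 2 - c * dist a u := by
      have e : h a = D / 2 - D / (dist a v + dist a u) * dist a u := by
        have := (hs0 a).ne'
        simp only [h]; field_simp; ring
      have : c ≤ D / (dist a v + dist a u) := (le_div_iff₀ (hs0 a)).2 h1.le
      have := mul_le_mul_of_nonneg_right this (dist_nonneg : 0 ≤ dist a u)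
      linarith
    have h4 : -(D / 2) + c * dist b v ≤ h b := by
      have e : h b = -(D / 2) + D / (dist b v + dist b u) * dist b v := by
        have := (hs0 b).ne'
        simp only [h]; field_simp; ring
      have : c ≤ D / (dist b v + dist b u) := (le_div_iff₀ (hs0 b)).2 h2.le
      have := mul_le_mul_of_nonneg_right this (dist_nonneg : 0 ≤ dist b v)
      linarith
    linarith

variable {o : M} {X : Type*} [NormedAddCommGroup X] [NormedSpace ℝ X] {δ : M → X}

theorem IsLipschitzFree.norm_molecule_sub_le (hX : IsLipschitzFree o δ) {a b u v : M}
    (hab : a ≠ b) (huv : u ≠ v) :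
    ‖molecule δ a b - molecule δ u v‖ ≤ 2 * (dist a u + dist b v) / dist u v := by
  have hd := dist_pos.2 hab
  have hD := dist_pos.2 huv
  have e : molecule δ a b - molecule δ u v = (dist u v)⁻¹ • ((δ a - δ u) - (δ b - δ v)) +
      ((dist a b)⁻¹ - (dist u v)⁻¹) • (δ a - δ b) := by
    simp only [molecule, smul_sub, sub_smul]; abel
  have h1 : |(dist a b)⁻¹ - (dist u v)⁻¹| * dist a b ≤ (dist a u + dist b v) / dist u v := by
    rw [inv_sub_inv hd.ne' hD.ne', abs_div, abs_of_pos (mul_pos hd hD), div_mul_eq_mul_div,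
      div_le_div_iff₀ (mul_pos hd hD) hD]
    have t1 := dist_triangle4 u a b v
    have t2 := dist_triangle4 a u v b
    rw [dist_comm u a] at t1
    rw [dist_comm v b] at t2
    have : |dist u v - dist a b| ≤ dist a u + dist b v := abs_le.2 ⟨by linarith, by linarith⟩
    nlinarith [mul_le_mul_of_nonneg_right this (mul_pos hd hD).le]
  rw [e, two_mul, add_div]
  refine (norm_add_le _ _).trans (add_le_add ?_ ?_)
  · rw [norm_smul, norm_inv, Real.norm_of_nonneg hD.le, div_eq_inv_mul]
    exact mul_le_mul_of_nonneg_left ((norm_sub_le _ _).trans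
      (add_le_add (hX.norm_map_sub_le _ _) (hX.norm_map_sub_le _ _))) (inv_nonneg.2 hD.le)
  · rw [norm_smul, Real.norm_eq_abs]
    exact (mul_le_mul_of_nonneg_left (hX.norm_map_sub_le a b) (abs_nonneg _)).trans h1

/-- Without approximate midpoints, the ball of the free space has a small slice: among the pairs at
which the function of `exists_nonlocal_function` is steep take `(u, v)` of almost minimal length.
Adding a large multiple of a function that peaks at `(u, v)` leaves only steep pairs almost between
`u` and `v`; these cannot be shorter, so they are close to `(u, v)`. -/
theorem IsLipschitzFree.hasSmallSlice (hX : IsLipschitzFree o δ) (hM : ¬ HasApproxMidpoints M) :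
    HasSmallSlice X := by
  obtain ⟨f, p, q, r, hf, hpq, hr, hfr⟩ := exists_nonlocal_function hM
  have hne : p ≠ q := by rintro rfl; simp at hpq
  have : Nontrivial M := ⟨p, q, hne⟩
  let S : Set ℝ := {t | ∃ u v, dist u v < f u - f v ∧ dist u v = t}
  have hSne : S.Nonempty := ⟨_, p, q, hpq, rfl⟩
  have hSb : BddBelow S := ⟨r, by rintro _ ⟨u, v, h, rfl⟩; exact hfr u v h⟩
  have hR : r ≤ sInf S := le_csInf hSne (by rintro _ ⟨u, v, h, rfl⟩; exact hfr u v h)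
  obtain ⟨_, ⟨u, v, huv', rfl⟩, hlt⟩ := exists_lt_of_csInf_lt hSne
    (show sInf S < 101 / 100 * sInf S by linarith)
  have hmin : ∀ a b, dist a b < f a - f b → dist u v ≤ 101 / 100 * dist a b := fun a b h => by
    have : sInf S ≤ dist a b := csInf_le hSb ⟨a, b, h, rfl⟩
    linarith
  have huv : u ≠ v := by rintro rfl; simp at huv'
  have hD := dist_pos.2 huv
  obtain ⟨h, hh, hhuv, hpeak⟩ := exists_peaking_function huv
  obtain ⟨φ, -, hφ⟩ := hX.exists_functional (f := fun z => f z + 100 * h z) (K := 102)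
    (by norm_num) fun a b => by
      have e : f a + 100 * h a - (f b + 100 * h b) = (f a - f b) + 100 * (h a - h b) := by ring
      rw [e]
      refine (abs_add_le _ _).trans ?_
      rw [abs_mul, abs_of_pos (by norm_num : (0 : ℝ) < 100)]
      linarith [hf a b, hh a b]
  have hmol : ∀ a b, φ (molecule δ a b) =
      (f a - f b) / dist a b + 100 * ((h a - h b) / dist a b) := fun a b => by
    rw [apply_molecule, hφ, hφ]; ring
  have hφuv : φ (molecule δ u v) = (f u - f v) / dist u v + 100 := by
    rw [hmol, hhuv, div_self hD.ne']; ring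
  obtain ⟨τ, hτ⟩ : ∃ τ, τ = (f u - f v) / dist u v - 1 := ⟨_, rfl⟩
  have hτ0 : 0 < τ := by rw [hτ, sub_pos, lt_div_iff₀ hD]; linarith
  have hnorm : φ (molecule δ u v) ≤ ‖φ‖ := by
    have h1 := (le_abs_self _).trans (φ.le_opNorm (molecule δ u v))
    rwa [hX.norm_molecule huv, mul_one] at h1
  refine ⟨φ, molecule δ u v, 2 / τ, by positivity, hX.norm_molecule huv, fun x hx => ?_⟩
  refine hX.mem_of_molecule_mem
    (S := {x | ‖x - molecule δ u v‖ ≤ 1 / 4 + 2 / τ * (‖φ‖ - φ x)}) ?_ ?_ (fun a b hab => ?_) hx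
  · have h1 : ConvexOn ℝ univ fun x : X => ‖x - molecule δ u v‖ := by
      simpa [dist_eq_norm] using convexOn_univ_dist (molecule δ u v)
    have h2 : ConvexOn ℝ univ fun x : X => ‖x - molecule δ u v‖ + 2 / τ * φ x :=
      h1.add (((2 / τ) • φ).toLinearMap.convexOn convex_univ)
    have h3 := h2.convex_le (1 / 4 + 2 / τ * ‖φ‖)
    convert h3 using 1
    ext x
    simp only [mem_univ, true_and, mem_ofPred_eq]
    rw [mul_sub, ← add_sub_assoc, le_sub_iff_add_le]
  · exact isClosed_le (by fun_prop) (by fun_prop)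
  · simp only [mem_ofPred_eq]
    have hd := dist_pos.2 hab
    rcases le_or_gt (φ (molecule δ a b)) (‖φ‖ - τ) with hc | hc
    · have h1 := (norm_sub_le (molecule δ a b) (molecule δ u v)).trans
        (add_le_add (hX.norm_molecule_le a b) (hX.norm_molecule_le u v))
      have h2 : 2 / τ * τ ≤ 2 / τ * (‖φ‖ - φ (molecule δ a b)) :=
        mul_le_mul_of_nonneg_left (by linarith) (by positivity)
      rw [div_mul_cancel₀ _ hτ0.ne'] at h2
      linarith
    · have h1 : 101 < φ (molecule δ a b) := by linarith
      rw [hmol] at h1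
      have h2 : (h a - h b) / dist a b ≤ 1 :=
        (div_le_one₀ hd).2 ((le_abs_self _).trans (hh a b))
      have h3 : (f a - f b) / dist a b ≤ 2 :=
        (div_le_iff₀ hd).2 ((le_abs_self _).trans (hf a b))
      have h4 : 1 < (f a - f b) / dist a b := by linarith
      have h5 : 99 / 100 < (h a - h b) / dist a b := by linarith
      rw [lt_div_iff₀ hd] at h4 h5
      have h6 := hpeak _ a b hab h5
      have h7 := hmin a b (by linarith)
      have h8 : 2 * (dist a u + dist b v) / dist u v ≤ 1 / 4 := by
        rw [div_le_iff₀ hD]; linarith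
      have h9 : 0 ≤ 2 / τ * (‖φ‖ - φ (molecule δ a b)) := by
        refine mul_nonneg (by positivity) (sub_nonneg.2 ?_)
        refine (le_abs_self _).trans ((φ.le_opNorm _).trans ?_)
        exact mul_le_of_le_one_right (norm_nonneg _) (hX.norm_molecule_le a b)
      linarith [hX.norm_molecule_sub_le hab huv]

end Slice

/-! ### Zigzags along almost geodesic chains -/

section Zigzag

variable {M : Type*} [MetricSpace M]

/-- A chain of `n` equally short steps whose total length `n * h = d(a, b) + s` is almost the
distance of its ends. -/
theorem HasApproxMidpoints.exists_chain [CompleteSpace M] (hM : HasApproxMidpoints M) (a b : M)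
    {s h : ℝ} (hs : 0 < s) {n : ℕ} (hn : 0 < n) (hh : n * h = dist a b + s) :
    ∃ c : ℕ → M, c 0 = a ∧ c n = b ∧ ∀ k, dist (c k) (c (k + 1)) ≤ h := by
  have hn' : (0 : ℝ) < n := by exact_mod_cast hn
  obtain ⟨γ, hγ, h0, h1⟩ := hM.exists_lipschitz_curve (L := dist a b + s) (p := a) (q := b)
    (by linarith)
  refine ⟨fun k => γ (k / n), by simpa using h0, by simpa [div_self hn'.ne'] using h1,
    fun k => (hγ _ _).trans (le_of_eq ?_)⟩
  rw [← hh, ← sub_div, abs_div, abs_of_pos hn']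
  push_cast
  rw [sub_add_cancel_left, abs_neg, abs_one]
  field_simp

/-- Along a chain with steps of length at most `h` a `1`-Lipschitz function can be followed by a
sequence that changes by exactly `h` in each step. -/
theorem exists_zigzag_seq {f : M → ℝ} (hf : ∀ a b, |f a - f b| ≤ dist a b) {c : ℕ → M} {h : ℝ}
    (hc : ∀ k, dist (c k) (c (k + 1)) ≤ h) :
    ∃ v : ℕ → ℝ, (∀ k, |v k - v (k + 1)| = h) ∧ ∀ k, |v k - f (c k)| ≤ 2 * h := by
  have h0 : 0 ≤ h := dist_nonneg.trans (hc 0)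
  -- The sequence goes up when it is below `f` and down when it is above `f`.
  let v : ℕ → ℝ := fun n => n.rec (motive := fun _ => ℝ) (f (c 0))
    fun k w => if w ≤ f (c k) then w + h else w - h
  have hv : ∀ k, v (k + 1) = if v k ≤ f (c k) then v k + h else v k - h := fun _ => rfl
  refine ⟨v, fun k => ?_, fun k => ?_⟩
  · rw [hv]
    split_ifs
    · rw [sub_add_cancel_left, abs_neg, abs_of_nonneg h0]
    · rw [sub_sub_cancel, abs_of_nonneg h0]
  · induction k with
    | zero => simpa [v] using h0
    | succ k ih =>
      have h1 := abs_le.1 ((hf (c k) (c (k + 1))).trans (hc k))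
      have h2 := abs_le.1 ih
      rw [hv, abs_le]
      split_ifs with hk
      · constructor <;> linarith [h1.1, h1.2, h2.1, h2.2]
      · rw [not_le] at hk
        constructor <;> linarith [h1.1, h1.2, h2.1, h2.2]

/-- A prescription `v` on finitely many points that satisfies the Lipschitz condition up to an
additive error `s` and follows `f` is almost attained by a Lipschitz function that is uniformly
close to `f`. -/
theorem exists_lipschitz_of_almost_lipschitz {f : M → ℝ} (hf : ∀ a b, |f a - f b| ≤ dist a b)
    {n : ℕ} {c : ℕ → M} {v : ℕ → ℝ} {s ρ : ℝ} (hs : 0 ≤ s)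
    (hv : ∀ k ≤ n, ∀ l ≤ n, |v k - v l| ≤ dist (c k) (c l) + s)
    (hvf : ∀ k ≤ n, |v k - f (c k)| + s ≤ ρ) :
    ∃ g : M → ℝ, (∀ a b, |g a - g b| ≤ dist a b) ∧ (∀ z, |g z - f z| ≤ ρ) ∧
      ∀ k ≤ n, v k - s ≤ g (c k) ∧ g (c k) ≤ v k := by
  -- The McShane extension of `v`, truncated to the strip of width `ρ` around `f`.
  let w : M → ℝ := fun z => ⨅ k : Fin (n + 1), (v k + dist z (c k))
  have hw : ∀ z k, k ≤ n → w z ≤ v k + dist z (c k) := fun z k hk =>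
    ciInf_le (f := fun k : Fin (n + 1) => v k + dist z (c k)) (Finite.bddBelow_range _)
      ⟨k, Nat.lt_succ_of_le hk⟩
  have hw1 : ∀ a b, w a - w b ≤ dist a b := fun a b => by
    rw [sub_le_iff_le_add, ← sub_le_iff_le_add']
    refine le_ciInf fun k => ?_
    linarith [hw a k (Nat.le_of_lt_succ k.2), dist_triangle a b (c k)]
  have hwlip : ∀ a b, |w a - w b| ≤ dist a b := fun a b =>
    abs_sub_le_iff.2 ⟨hw1 a b, by rw [dist_comm]; exact hw1 b a⟩
  have hρ : 0 ≤ ρ := le_trans (by positivity) (hvf 0 (Nat.zero_le n))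
  refine ⟨fun z => max (f z - ρ) (min (w z) (f z + ρ)), fun a b => ?_, fun z => ?_,
    fun k hk => ?_⟩
  · refine (abs_max_sub_max_le_max _ _ _ _).trans (max_le ?_ ?_)
    · rw [sub_sub_sub_cancel_right]; exact hf a b
    · refine (abs_min_sub_min_le_max _ _ _ _).trans (max_le (hwlip a b) ?_)
      rw [add_sub_add_right_eq_sub]; exact hf a b
  · rw [abs_le]
    constructor
    · linarith [le_max_left (f z - ρ) (min (w z) (f z + ρ))]
    · have : max (f z - ρ) (min (w z) (f z + ρ)) ≤ f z + ρ :=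
        max_le (by linarith) (min_le_right _ _)
      linarith
  · have h1 : w (c k) ≤ v k := by simpa using hw (c k) k hk
    have h2 : v k - s ≤ w (c k) := le_ciInf fun l => by
      linarith [(abs_le.1 (hv k hk l (Nat.le_of_lt_succ l.2))).2]
    have h3 := abs_le.1 (le_sub_iff_add_le.2 (hvf k hk))
    have h4 : max (f (c k) - ρ) (min (w (c k)) (f (c k) + ρ)) = w (c k) := by
      rw [min_eq_left (by linarith [h3.2]), max_eq_right (by linarith [h3.1])]
    dsimp only
    rw [h4]
    exact ⟨h2, h1⟩

/-- Each `1`-Lipschitz function is uniformly close to a `1`-Lipschitz function that has almost the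
largest possible variation along some almost geodesic chain from `a` to `b`. -/
theorem HasApproxMidpoints.exists_zigzag_function [CompleteSpace M] (hM : HasApproxMidpoints M)
    {f : M → ℝ} (hf : ∀ a b, |f a - f b| ≤ dist a b) (a b : M) {ρ η : ℝ} (hρ : 0 < ρ)
    (hη : 0 < η) :
    ∃ (g : M → ℝ) (n : ℕ) (c : ℕ → M) (h s : ℝ), (∀ a b, |g a - g b| ≤ dist a b) ∧
      (∀ z, |g z - f z| ≤ ρ) ∧ c 0 = a ∧ c n = b ∧ (∀ k, dist (c k) (c (k + 1)) ≤ h) ∧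
      dist a b ≤ n * h ∧ n * h ≤ dist a b + η ∧ n * s ≤ η ∧
      ∀ k < n, h - s ≤ |g (c k) - g (c (k + 1))| := by
  obtain ⟨n, hn⟩ := exists_nat_gt (4 * (dist a b + 1) / ρ)
  have hn0 : (0 : ℝ) < n := lt_of_le_of_lt (by positivity) hn
  rw [div_lt_iff₀ hρ] at hn
  let s := min (min 1 (ρ / 2)) (η / n)
  have hs : 0 < s := by positivity
  have hs1 : s ≤ 1 := (min_le_left _ _).trans (min_le_left _ _)
  have hs2 : s ≤ ρ / 2 := (min_le_left _ _).trans (min_le_right _ _)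
  have hs3 : n * s ≤ η := (le_div_iff₀' hn0).1 (min_le_right _ _)
  obtain ⟨h, hh⟩ : ∃ h, h = (dist a b + s) / n := ⟨_, rfl⟩
  have hnh : n * h = dist a b + s := by rw [hh]; field_simp
  have hhρ : 4 * h ≤ ρ := by
    rw [hh, mul_div_assoc', div_le_iff₀ hn0]; linarith
  have hn1 : (1 : ℝ) ≤ n := by exact_mod_cast (Nat.cast_pos.1 hn0 : 0 < n)
  obtain ⟨c, hc0, hcn, hc⟩ := hM.exists_chain a b hs (Nat.cast_pos.1 hn0) hnh
  obtain ⟨v, hv, hvf⟩ := exists_zigzag_seq hf hc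
  have hvlip : ∀ k l, |v k - v l| ≤ h * |(k : ℝ) - l| := fun k l => by
    simpa only [Real.dist_eq] using dist_le_mul_of_dist_succ_le
      (fun k => (Real.dist_eq (v k) (v (k + 1))).trans_le (hv k).le) k l
  -- The chain is so short that its points are almost as far apart as along the chain.
  have hfar : ∀ k l, k ≤ l → l ≤ n → h * |(k : ℝ) - l| ≤ dist (c k) (c l) + s := by
    intro k l hkl hln
    have e1 : (k : ℝ) ≤ l := by exact_mod_cast hkl
    have e2 : (l : ℝ) ≤ n := by exact_mod_cast hln
    have h1 := dist_le_mul_of_dist_succ_le hc 0 k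
    have h2 := dist_le_mul_of_dist_succ_le hc l n
    rw [hc0, abs_sub_comm, Nat.cast_zero, sub_zero, abs_of_nonneg (Nat.cast_nonneg k)] at h1
    rw [hcn, abs_sub_comm, abs_of_nonneg (sub_nonneg.2 e2)] at h2
    rw [abs_sub_comm, abs_of_nonneg (sub_nonneg.2 e1)]
    linarith [dist_triangle4 a (c k) (c l) b]
  obtain ⟨g, hg, hgf, hgv⟩ := exists_lipschitz_of_almost_lipschitz (n := n) (c := c) (v := v)
    (s := s) (ρ := ρ) hf hs.le (fun k hk l hl => by
      rcases le_total k l with hkl | hkl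
      · exact (hvlip k l).trans (hfar k l hkl hl)
      · rw [abs_sub_comm, dist_comm]
        exact (hvlip l k).trans (hfar l k hkl hk)) (fun k _ => by linarith [hvf k])
  refine ⟨g, n, c, h, s, hg, hgf, hc0, hcn, hc, by linarith, by nlinarith, hs3, fun k hk => ?_⟩
  have h1 := hgv k hk.le
  have h2 := hgv (k + 1) hk
  have h3 := hv k
  rcases abs_cases (v k - v (k + 1)) with h' | h' <;> rw [h'.1] at h3
  · exact le_trans (by linarith) (le_abs_self _)
  · exact le_trans (by linarith) (neg_le_abs _)

variable {o : M} {X : Type*} [NormedAddCommGroup X] [NormedSpace ℝ X] {δ : M → X}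

/-- A functional of norm at most one can be changed, by little at the points `δ z`, so as to split `δ a - δ b`
into two parts `P` and `Q`, of total norm almost `d(a, b)`, at which it almost attains the norm,
with opposite signs. These are the ascending and the descending steps of a zigzag. -/
theorem IsLipschitzFree.exists_splitting [CompleteSpace M] (hX : IsLipschitzFree o δ)
    (hM : HasApproxMidpoints M) {φ : StrongDual ℝ X} (hφ : ‖φ‖ ≤ 1) (a b : M) {ρ η : ℝ}
    (hρ : 0 < ρ) (hη : 0 < η) :
    ∃ (ψ : StrongDual ℝ X) (P Q : X) (lP lQ : ℝ), ‖ψ‖ ≤ 1 ∧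
      (∀ z, |ψ (δ z) - φ (δ z)| ≤ ρ) ∧ P ∈ Submodule.span ℝ (range δ) ∧
      Q ∈ Submodule.span ℝ (range δ) ∧ P + Q = δ a - δ b ∧ ‖P‖ ≤ lP ∧ ‖Q‖ ≤ lQ ∧
      lP + lQ ≤ dist a b + η ∧ dist a b - η ≤ ψ P - ψ Q := by
  obtain ⟨g, n, c, h, s, hg, hgf, hc0, hcn, hc, hd1, hd2, hs, hgc⟩ :=
    hM.exists_zigzag_function (f := fun z => φ (δ z)) (fun p q =>
      (hX.abs_sub_le φ p q).trans (mul_le_of_le_one_left dist_nonneg hφ)) a b (half_pos hρ) hη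
  have h0 : 0 ≤ h := dist_nonneg.trans (hc 0)
  obtain ⟨ψ, hψ, hψg⟩ := hX.exists_functional zero_le_one (f := g) (by simpa using hg)
  have hmem : ∀ k, δ (c k) - δ (c (k + 1)) ∈ Submodule.span ℝ (range δ) := fun k =>
    sub_mem (Submodule.subset_span (mem_range_self _)) (Submodule.subset_span (mem_range_self _))
  have hstep : ∀ k, ‖δ (c k) - δ (c (k + 1))‖ ≤ h := fun k =>
    (hX.norm_map_sub_le _ _).trans (hc k)
  have hval : ∀ k, ψ (δ (c k) - δ (c (k + 1))) = g (c k) - g (c (k + 1)) := fun k => by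
    rw [map_sub, hψg, hψg, sub_sub_sub_cancel_right]
  refine ⟨ψ,
    ∑ k ∈ Finset.range n, if 0 ≤ g (c k) - g (c (k + 1)) then δ (c k) - δ (c (k + 1)) else 0,
    ∑ k ∈ Finset.range n, if 0 ≤ g (c k) - g (c (k + 1)) then 0 else δ (c k) - δ (c (k + 1)),
    ∑ k ∈ Finset.range n, if 0 ≤ g (c k) - g (c (k + 1)) then h else 0,
    ∑ k ∈ Finset.range n, if 0 ≤ g (c k) - g (c (k + 1)) then 0 else h,
    hψ, fun z => ?_, ?_, ?_, ?_, ?_, ?_, ?_, ?_⟩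
  · have h1 := hgf o
    rw [hX.map_base, map_zero, sub_zero] at h1
    rw [hψg, sub_right_comm]
    exact (abs_sub _ _).trans (by linarith [hgf z])
  · refine sum_mem fun k _ => ?_
    split_ifs
    exacts [hmem k, zero_mem _]
  · refine sum_mem fun k _ => ?_
    split_ifs
    exacts [zero_mem _, hmem k]
  · rw [← Finset.sum_add_distrib, ← hc0, ← hcn, ← Finset.sum_range_sub' (fun k => δ (c k))]
    refine Finset.sum_congr rfl fun k _ => ?_
    split_ifs <;> simp
  · refine norm_sum_le_of_le _ fun k _ => ?_
    split_ifs
    exacts [hstep k, norm_zero.le]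
  · refine norm_sum_le_of_le _ fun k _ => ?_
    split_ifs
    exacts [norm_zero.le, hstep k]
  · rw [← Finset.sum_add_distrib]
    refine le_trans (le_of_eq ?_) hd2
    rw [Finset.sum_congr rfl (g := fun _ => h) fun k _ => by split_ifs <;> simp]
    simp
  · rw [map_sum, map_sum, ← Finset.sum_sub_distrib]
    have h1 : ∑ _k ∈ Finset.range n, (h - s) ≤ ∑ k ∈ Finset.range n,
        (ψ (if 0 ≤ g (c k) - g (c (k + 1)) then δ (c k) - δ (c (k + 1)) else 0) -
          ψ (if 0 ≤ g (c k) - g (c (k + 1)) then 0 else δ (c k) - δ (c (k + 1)))) := by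
      refine Finset.sum_le_sum fun k hk => (hgc k (Finset.mem_range.1 hk)).trans (le_of_eq ?_)
      split_ifs with hk0
      · rw [map_zero, sub_zero, hval, abs_of_nonneg hk0]
      · rw [map_zero, zero_sub, hval, abs_of_neg (not_le.1 hk0)]
    rw [Finset.sum_const, Finset.card_range, nsmul_eq_mul, mul_sub] at h1
    linarith

end Zigzag

/-! ### Locally almost square free spaces -/

section AlmostSquare

variable {ι X : Type*} [NormedAddCommGroup X] [NormedSpace ℝ X]

/-- `x` has partners `y` as in the definition of local almost squareness, which moreover lie in the
span of the points `δ z` and are normed by a small perturbation of any given functional of norm at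
most one that is uniformly small at the points `δ z`. This is the form of the property that passes
to convex combinations. -/
def IsStablyAlmostSquareAt (δ : ι → X) (x : X) : Prop :=
  ∀ ε : ℝ, 0 < ε → ∃ η : ℝ, 0 < η ∧ ∀ φ : StrongDual ℝ X, ‖φ‖ ≤ 1 → (∀ z, |φ (δ z)| ≤ η) →
    ∀ ρ : ℝ, 0 < ρ → ∃ (ψ : StrongDual ℝ X) (y : X), ‖ψ‖ ≤ 1 ∧
      (∀ z, |ψ (δ z) - φ (δ z)| ≤ ρ) ∧ y ∈ Submodule.span ℝ (range δ) ∧ 1 - ε ≤ ψ y ∧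
      ‖x + y‖ ≤ 1 + ε ∧ ‖x - y‖ ≤ 1 + ε

theorem convex_isStablyAlmostSquareAt [Nonempty ι] (δ : ι → X) :
    Convex ℝ {x | IsStablyAlmostSquareAt δ x} := by
  intro x₁ hx₁ x₂ hx₂ a b ha hb hab ε hε
  obtain ⟨η₁, hη₁, H₁⟩ := hx₁ (ε / 2) (half_pos hε)
  obtain ⟨η₂, hη₂, H₂⟩ := hx₂ ε hε
  refine ⟨min η₁ (η₂ / 2), by positivity, fun φ hφ hφη ρ hρ => ?_⟩
  obtain ⟨φ₁, y₁, hφ₁, h₁, hy₁, hv₁, hp₁, hm₁⟩ :=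
    H₁ φ hφ (fun z => (hφη z).trans (min_le_left _ _)) (min (ρ / 2) (η₂ / 2)) (by positivity)
  obtain ⟨C, hC, hCy⟩ := exists_abs_apply_sub_le hy₁
  obtain ⟨φ₂, y₂, hφ₂, h₂, hy₂, hv₂, hp₂, hm₂⟩ := H₂ φ₁ hφ₁ (fun z => by
    have e := abs_add_le (φ₁ (δ z) - φ (δ z)) (φ (δ z))
    rw [sub_add_cancel] at e
    linarith [h₁ z, hφη z, min_le_right (ρ / 2) (η₂ / 2), min_le_right η₁ (η₂ / 2)])
    (min (ρ / 2) (ε / (2 * C))) (by positivity)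
  have hv : 1 - ε ≤ φ₂ y₁ := by
    have h3 := hCy φ₂ φ₁ _ h₂
    have h4 : C * min (ρ / 2) (ε / (2 * C)) ≤ C * (ε / (2 * C)) :=
      mul_le_mul_of_nonneg_left (min_le_right _ _) hC.le
    have h5 : C * (ε / (2 * C)) = ε / 2 := by field_simp
    linarith [neg_abs_le (φ₂ y₁ - φ₁ y₁)]
  have hcomb : ∀ r s t : ℝ, r ≤ t → s ≤ t → a * r + b * s ≤ t := fun r s t hr hs => by
    have e : t = a * t + b * t := by rw [← add_mul, hab, one_mul]
    rw [e]
    exact add_le_add (mul_le_mul_of_nonneg_left hr ha) (mul_le_mul_of_nonneg_left hs hb)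
  have hnorm : ∀ z₁ z₂ : X, ‖z₁‖ ≤ 1 + ε → ‖z₂‖ ≤ 1 + ε → ‖a • z₁ + b • z₂‖ ≤ 1 + ε :=
    fun z₁ z₂ e₁ e₂ => by
      refine (norm_add_le _ _).trans ?_
      rw [norm_smul, norm_smul, Real.norm_of_nonneg ha, Real.norm_of_nonneg hb]
      exact hcomb _ _ _ e₁ e₂
  refine ⟨φ₂, a • y₁ + b • y₂, hφ₂, fun z => ?_,
    add_mem (Submodule.smul_mem _ _ hy₁) (Submodule.smul_mem _ _ hy₂), ?_, ?_, ?_⟩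
  · have e := abs_sub_le (φ₂ (δ z)) (φ₁ (δ z)) (φ (δ z))
    linarith [h₁ z, h₂ z, min_le_left (ρ / 2) (η₂ / 2), min_le_left (ρ / 2) (ε / (2 * C))]
  · rw [map_add, map_smul, map_smul, smul_eq_mul, smul_eq_mul]
    have := hcomb (-φ₂ y₁) (-φ₂ y₂) (-(1 - ε)) (by linarith) (by linarith)
    linarith
  · have e : a • x₁ + b • x₂ + (a • y₁ + b • y₂) = a • (x₁ + y₁) + b • (x₂ + y₂) := by
      simp only [smul_add]; abel
    rw [e]
    exact hnorm _ _ (by linarith) hp₂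
  · have e : a • x₁ + b • x₂ - (a • y₁ + b • y₂) = a • (x₁ - y₁) + b • (x₂ - y₂) := by
      simp only [smul_sub]; abel
    rw [e]
    exact hnorm _ _ (by linarith) hm₂

end AlmostSquare

section Main

variable {M : Type*} [MetricSpace M] {o : M} {X : Type*} [NormedAddCommGroup X] [NormedSpace ℝ X]
  {δ : M → X}

/-- For a molecule the partner is `(P - Q) / d(a, b)` with the ascending part `P` and the descending
part `Q` of a zigzag from `a` to `b`. As the functional is small, both have norm about
`d(a, b) / 2`. -/
theorem IsLipschitzFree.isStablyAlmostSquareAt_molecule [CompleteSpace M]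
    (hX : IsLipschitzFree o δ) (hM : HasApproxMidpoints M) {a b : M} (hab : a ≠ b) :
    IsStablyAlmostSquareAt δ (molecule δ a b) := by
  intro ε hε
  have hd := dist_pos.2 hab
  obtain ⟨d, hdd⟩ : ∃ d, d = dist a b := ⟨_, rfl⟩
  rw [← hdd] at hd
  refine ⟨ε * d / 16, by positivity, fun φ hφ hφη ρ hρ => ?_⟩
  obtain ⟨ψ, P, Q, lP, lQ, hψ, hψφ, hP, hQ, hPQ, hlP, hlQ, hl, hval⟩ :=
    hX.exists_splitting hM hφ a b (ρ := min ρ (ε * d / 16)) (η := ε * d / 16)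
      (by positivity) (by positivity)
  rw [← hdd] at hl hval
  have hsmall : ∀ z, |ψ (δ z)| ≤ ε * d / 8 := fun z => by
    have e := abs_add_le (ψ (δ z) - φ (δ z)) (φ (δ z))
    rw [sub_add_cancel] at e
    linarith [hψφ z, hφη z, min_le_right ρ (ε * d / 16)]
  have hsum : ψ P + ψ Q = ψ (δ a) - ψ (δ b) := by rw [← map_add, hPQ, map_sub]
  have ha := abs_le.1 (hsmall a)
  have hb := abs_le.1 (hsmall b)
  have h1 := (apply_le_norm hψ P).trans hlP
  have h2 : -ψ Q ≤ lQ := by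
    have := apply_le_norm hψ (-Q)
    rw [map_neg, norm_neg] at this
    exact this.trans hlQ
  have hhalf : ∀ (R : X) (l : ℝ), ‖R‖ ≤ l → 2 * l ≤ d + ε * d → ‖d⁻¹ • (R + R)‖ ≤ 1 + ε := by
    intro R l h3 h4
    rw [norm_smul, norm_inv, Real.norm_of_nonneg hd.le, inv_mul_le_iff₀ hd]
    linarith [norm_add_le R R]
  refine ⟨ψ, d⁻¹ • (P - Q), hψ, fun z => (hψφ z).trans (min_le_left _ _),
    Submodule.smul_mem _ _ (sub_mem hP hQ), ?_, ?_, ?_⟩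
  · rw [map_smul, map_sub, smul_eq_mul, ← div_eq_inv_mul, le_div_iff₀ hd]
    nlinarith
  · have e : molecule δ a b + d⁻¹ • (P - Q) = d⁻¹ • (P + P) := by
      rw [molecule, ← hdd, ← hPQ, ← smul_add]; congr 1; abel
    rw [e]
    exact hhalf P lP hlP (by nlinarith)
  · have e : molecule δ a b - d⁻¹ • (P - Q) = d⁻¹ • (Q + Q) := by
      rw [molecule, ← hdd, ← hPQ, ← smul_sub]; congr 1; abel
    rw [e]
    exact hhalf Q lQ hlQ (by nlinarith)

theorem IsLipschitzFree.isLASQ [CompleteSpace M] [Nontrivial M] (hX : IsLipschitzFree o δ)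
    (hM : HasApproxMidpoints M) : IsLASQ X := by
  intro ε hε x hx
  have hcl : x ∈ closure {x | IsStablyAlmostSquareAt δ x} :=
    hX.mem_of_molecule_mem (convex_isStablyAlmostSquareAt δ).closure isClosed_closure
      (fun a b hab => subset_closure (hX.isStablyAlmostSquareAt_molecule hM hab)) hx.le
  obtain ⟨ε', hε'0, hε'1, hε'ε⟩ : ∃ ε' : ℝ, 0 < ε' ∧ ε' < 1 ∧ 3 * ε' ≤ ε :=
    ⟨min (1 / 2) (ε / 3), by positivity, (min_le_left _ _).trans_lt (by norm_num),
      by linarith [min_le_right (1 / 2) (ε / 3)]⟩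
  obtain ⟨x', hx', hxx'⟩ := Metric.mem_closure_iff.1 hcl ε' hε'0
  rw [dist_eq_norm] at hxx'
  obtain ⟨η, hη, H⟩ := hx' ε' hε'0
  obtain ⟨ψ, y, hψ, -, -, hv, hp, hm⟩ := H 0 (by simp) (by simpa using hη.le) 1 one_pos
  have hy1 : 1 - ε' ≤ ‖y‖ := hv.trans (apply_le_norm hψ y)
  have hy0 : 0 < ‖y‖ := by linarith
  have hy2 : ‖y‖ ≤ 1 + ε' := by
    have h1 := norm_sub_le (x' + y) (x' - y)
    rw [add_sub_sub_cancel, ← two_smul ℝ y, norm_smul, Real.norm_two] at h1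
    linarith
  have hyy : ‖y - ‖y‖⁻¹ • y‖ ≤ ε' := by
    have e : y - ‖y‖⁻¹ • y = (1 - ‖y‖⁻¹) • y := by rw [sub_smul, one_smul]
    rw [e, norm_smul, Real.norm_eq_abs, ← abs_of_pos hy0, ← abs_mul, abs_of_pos hy0, sub_mul,
      inv_mul_cancel₀ hy0.ne', one_mul, abs_le]
    constructor <;> linarith
  refine ⟨‖y‖⁻¹ • y, by rw [norm_smul, norm_inv, norm_norm, inv_mul_cancel₀ hy0.ne'], ?_, ?_⟩
  · have e : x + ‖y‖⁻¹ • y = (x' + y) + (x - x') - (y - ‖y‖⁻¹ • y) := by abel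
    rw [e]
    linarith [norm_sub_le ((x' + y) + (x - x')) (y - ‖y‖⁻¹ • y), norm_add_le (x' + y) (x - x')]
  · have e : x - ‖y‖⁻¹ • y = (x' - y) + (x - x') + (y - ‖y‖⁻¹ • y) := by abel
    rw [e]
    linarith [norm_add_le ((x' - y) + (x - x')) (y - ‖y‖⁻¹ • y), norm_add_le (x' - y) (x - x')]

/-! ### Free spaces with the Daugavet property -/

/-- The quantitative form of the Daugavet equation: take a molecule `(a, b)` that almost norms `φ`
and a functional that almost norms `x`, and evaluate the latter, after a small change, at the image
of the ascending part of a zigzag from `a` to `b`. -/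
theorem IsLipschitzFree.daugavet_estimate [CompleteSpace M] [Nontrivial M]
    (hX : IsLipschitzFree o δ) (hM : HasApproxMidpoints M) (φ : StrongDual ℝ X) (x : X) {ε : ℝ}
    (hε : 0 < ε) (hε4 : ε ≤ 1 / 4) :
    1 + ‖φ‖ * ‖x‖ ≤ ‖ContinuousLinearMap.id ℝ X + φ.smulRight x‖ +
      ε * (8 + 4 * (‖φ‖ + 1) * ‖x‖ + ‖φ‖ * (‖x‖ + 3)) := by
  obtain ⟨x', hx', hxx'⟩ := Metric.mem_closure_iff.1 (hX.dense_span x) ε hε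
  rw [dist_eq_norm] at hxx'
  obtain ⟨C, hC, hCx⟩ := exists_abs_apply_sub_le hx'
  obtain ⟨ψ₀, hψ₀, hψ₀x⟩ := exists_dual_vector'' ℝ x
  replace hψ₀x : ψ₀ x = ‖x‖ := by simpa using hψ₀x
  have hψn : ‖(1 - ε) • ψ₀‖ ≤ 1 - ε := by
    rw [norm_smul, Real.norm_of_nonneg (by linarith)]
    exact mul_le_of_le_one_right (by linarith) hψ₀
  obtain ⟨a, b, hab, hφab⟩ := hX.exists_lt_apply_molecule φ (r := ‖φ‖ - ε ^ 2)
    (by linarith [pow_pos hε 2])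
  have hd := dist_pos.2 hab
  have hab' := hX.abs_sub_le ((1 - ε) • ψ₀) a b
  rw [apply_molecule, lt_div_iff₀ hd] at hφab
  obtain ⟨d, hdd⟩ : ∃ d, d = dist a b := ⟨_, rfl⟩
  obtain ⟨ψ, P, Q, lP, lQ, hψ, hψψ, -, -, hPQ, hlP, hlQ, hl, hval⟩ :=
    hX.exists_splitting hM (hψn.trans (by linarith)) a b (ρ := min (ε * d / 8) (ε / C))
      (η := ε ^ 2 * d) (by rw [← hdd] at hd; positivity) (by rw [← hdd] at hd; positivity)
  rw [← hdd] at hd hφab hab' hl hval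
  have hρ1 : min (ε * d / 8) (ε / C) ≤ ε * d / 8 := min_le_left _ _
  have hρ2 : C * min (ε * d / 8) (ε / C) ≤ ε := (le_div_iff₀' hC).1 (min_le_right _ _)
  -- The functional `ψ` almost norms `x`.
  have hψx1 : ψ x ≤ ‖x‖ := apply_le_norm hψ x
  have hψx2 : ‖x‖ - ε * (‖x‖ + 3) ≤ ψ x := by
    have h1 := (neg_abs_le _).trans' (neg_le_neg ((hCx _ _ _ hψψ).trans hρ2))
    have h2 := apply_le_norm hψ (x' - x)
    have h3 := apply_le_norm (hψn.trans (by linarith)) (x - x')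
    rw [map_sub, norm_sub_rev] at h2
    rw [map_sub] at h3
    have h4 : ((1 - ε) • ψ₀) x = (1 - ε) * ‖x‖ := by
      simp [hψ₀x]
    linarith
  -- The functional `ψ` almost norms `P`, and `P` is not too short.
  have h1 := (apply_le_norm hψ P).trans hlP
  have h2 : -ψ Q ≤ lQ := by
    have := apply_le_norm hψ (-Q)
    rw [map_neg, norm_neg] at this
    exact this.trans hlQ
  have hψP : lP - 2 * (ε ^ 2 * d) ≤ ψ P := by linarith
  have hεd : ε ^ 2 * d ≤ ε * d / 4 := by nlinarith [mul_pos hε hd]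
  have hlong : ε * d ≤ 4 * lP := by
    have hsum : ψ P + ψ Q = ψ (δ a) - ψ (δ b) := by rw [← map_add, hPQ, map_sub]
    have ha := abs_le.1 (hψψ a)
    have hb := abs_le.1 (hψψ b)
    have h3 := neg_abs_le (((1 - ε) • ψ₀) (δ a) - ((1 - ε) • ψ₀) (δ b))
    have h4 := mul_le_mul_of_nonneg_right hψn hd.le
    linarith [ha.1, hb.2]
  have hlP0 : 0 < lP := by nlinarith [mul_pos hε hd]
  -- The functional `φ` almost attains its norm at `P`, since it does so at `P + Q`.
  have hφP1 : φ P ≤ ‖φ‖ * lP :=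
    (le_abs_self _).trans ((φ.le_opNorm P).trans (mul_le_mul_of_nonneg_left hlP (norm_nonneg _)))
  have hφP2 : ‖φ‖ * lP - ε ^ 2 * d * (‖φ‖ + 1) ≤ φ P := by
    have hsum : φ P + φ Q = φ (δ a) - φ (δ b) := by rw [← map_add, hPQ, map_sub]
    have h3 : φ Q ≤ ‖φ‖ * lQ :=
      (le_abs_self _).trans ((φ.le_opNorm Q).trans (mul_le_mul_of_nonneg_left hlQ (norm_nonneg _)))
    have h4 := mul_le_mul_of_nonneg_left hl (norm_nonneg φ)
    linarith
  obtain ⟨K, hK⟩ : ∃ K, K = ‖ContinuousLinearMap.id ℝ X + φ.smulRight x‖ := ⟨_, rfl⟩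
  rw [← hK]
  have hmain : ψ P + φ P * ψ x ≤ K * lP := by
    have h3 := apply_le_norm hψ ((ContinuousLinearMap.id ℝ X + φ.smulRight x) P)
    have h4 := ContinuousLinearMap.le_opNorm (ContinuousLinearMap.id ℝ X + φ.smulRight x) P
    have e : ψ ((ContinuousLinearMap.id ℝ X + φ.smulRight x) P) = ψ P + φ P * ψ x := by
      simp
    rw [e] at h3
    rw [← hK] at h4
    have h5 : 0 ≤ K := by rw [hK]; exact norm_nonneg _
    exact h3.trans (h4.trans (mul_le_mul_of_nonneg_left hlP h5))
  have hN := norm_nonneg φ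
  have hx0 := norm_nonneg x
  have hprod : φ P * ‖x‖ - ‖φ‖ * lP * (ε * (‖x‖ + 3)) ≤ φ P * ψ x := by
    have h3 : φ P * (‖x‖ - ψ x) ≤ ‖φ‖ * lP * (‖x‖ - ψ x) :=
      mul_le_mul_of_nonneg_right hφP1 (by linarith)
    have h4 : ‖φ‖ * lP * (‖x‖ - ψ x) ≤ ‖φ‖ * lP * (ε * (‖x‖ + 3)) :=
      mul_le_mul_of_nonneg_left (by linarith) (by positivity)
    linarith
  have hφPx := mul_le_mul_of_nonneg_right hφP2 hx0
  have hεl : ε ^ 2 * d ≤ 4 * ε * lP := by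
    have := mul_le_mul_of_nonneg_left hlong hε.le
    linarith
  have hεlx := mul_le_mul_of_nonneg_right hεl (by positivity : 0 ≤ (‖φ‖ + 1) * ‖x‖)
  refine le_of_mul_le_mul_right ?_ hlP0
  linarith

theorem IsLipschitzFree.hasDaugavetProperty [CompleteSpace M] [Nontrivial M]
    (hX : IsLipschitzFree o δ) (hM : HasApproxMidpoints M) : HasDaugavetProperty X := by
  intro φ x
  rw [ContinuousLinearMap.norm_smulRight_apply]
  refine le_antisymm ?_ ?_
  · refine (norm_add_le _ _).trans (add_le_add ContinuousLinearMap.norm_id_le ?_)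
    rw [ContinuousLinearMap.norm_smulRight_apply]
  · refine le_of_forall_pos_le_add fun e he => ?_
    obtain ⟨B, hB⟩ : ∃ B, B = 8 + 4 * (‖φ‖ + 1) * ‖x‖ + ‖φ‖ * (‖x‖ + 3) := ⟨_, rfl⟩
    have hB0 : 0 < B := by rw [hB]; positivity
    have h1 := hX.daugavet_estimate hM φ x (ε := min (1 / 4) (e / B)) (by positivity)
      (min_le_left _ _)
    rw [← hB] at h1
    have h2 : min (1 / 4) (e / B) * B ≤ e := (le_div_iff₀ hB0).1 (min_le_right _ _)
    linarith

end Main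

end LipFree

theorem theorem3p1 {M : Type*} [MetricSpace M] [CompleteSpace M] [Nontrivial M] (o : M) :
    (LipFree.IsLASQ (LipFree.freeSpace o) ↔ LipFree.IsLengthSpace M) ∧
      (LipFree.IsLASQ (LipFree.freeSpace o) ↔
        LipFree.HasDaugavetProperty (LipFree.freeSpace o)) := by
  have hX := LipFree.isLipschitzFree_freeSpace o
  have h1 : LipFree.IsLASQ (LipFree.freeSpace o) ↔ LipFree.HasApproxMidpoints M :=
    ⟨fun h => by_contra fun hM => (hX.hasSmallSlice hM).not_isLASQ h, hX.isLASQ⟩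
  have h2 : LipFree.HasDaugavetProperty (LipFree.freeSpace o) ↔ LipFree.HasApproxMidpoints M :=
    ⟨fun h => by_contra fun hM => (hX.hasSmallSlice hM).not_hasDaugavetProperty h,
      hX.hasDaugavetProperty⟩
  exact ⟨h1.trans ⟨fun h => h.isLengthSpace, fun h => h.hasApproxMidpoints⟩, h1.trans h2.symm⟩
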